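/- **Notation.** Let $n\ge 0$, let $\mathbb R\langle x_1,\dots,x_n\rangle$ be the algebra of real polynomials in non-commuting variables, with the linear involution $*$ that reverses monomials, and let $\mathbf z=(z_1,\dots,z_n)$ be non-commuting formal indeterminates that commute with the $x_i$. For a word $u=(u(1),\dots,u(k))$ in the letters $1,\dots,n$, put $x_u=x_{u(1)}\cdots x_{u(k)}$ and $z_u=z_{u(1)}\cdots z_{u(k)}$. A *state* is a linear functional $\varphi$ with $\varphi[1]=1$ and $\varphi[S^*S]\ge 0$ for all $S$; it is *faithful* if $\varphi[S^*S]=0$ only for $S=0$. For a unital functional $\varphi$ let $M(\mathbf w)=\sum_{|u|\ge1}\varphi[x_u]w_u$; its free cumulant generating function is the series $R(\mathbf z)=\sum_{|u|\ge 1}R[x_u]z_u$ with $R\bigl(w_1(1+M(\mathbf w)),\dots,w_n(1+M(\mathbf w))\bigr)=M(\mathbf w)$. The *free product* of unital functionals $\psi_i$ on $\mathbb R[x_i]$, $i=1,\dots,n$, is the unital functional $\varphi$ with $R_\varphi[x_u]=0$ unless all $u(j)$ are equal, and $R_\varphi[x_i^k]=R_{\psi_i}[x_i^k]$. Let $D_i$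 be the left partial derivative, $D_i1=0$, $D_i(z_jz_u)=\delta_{ij}z_u$. If $\varphi[x_i]=0$ and $\varphi[x_ix_j]=\delta_{ij}$, let $\mathbf U$ be determined by $(D_iR)(\mathbf U(\mathbf z))=z_i$, where the $U_i$ have no constant term; the *free Sheffer polynomials* $P_u$ of $\varphi$ are given by $\sum_uP_u(\mathbf x)z_u=\bigl(1-\mathbf x\cdot\mathbf U(\mathbf z)+R(\mathbf U(\mathbf z))\bigr)^{-1}$. A state $\varphi$ on $\mathbb R\langle x_1,\dots,x_n\rangle$ with $\varphi[x_i]=0$, $\varphi[x_ix_j]=\delta_{ij}$ is a *free Meixner state* if these polynomials are orthogonal, that is, $\varphi[P_u^*P_v]=0$ for all words $u\ne v$. For $b,c\in\mathbb R$, the *one-dimensional free Meixner state* $\varphi^{b,c}$ is the state on $\mathbb R[x]$ whose free cumulant generating function satisfies $$R(z)/z^2=1+b\,R(z)/z+c\,(R(z)/z)^2,\qquad(1)$$ an equation between power series. The *one-variable free Meixner polynomials* $P_k^{b,c}$ are given by $\sum_kP^{b,c}_k(x)z^k=(1-xU(z)+R(U(z)))^{-1}$ with $R$ the solution of (1) and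 $U=(R(z)/z)^{\langle-1\rangle}$ the inverse under composition. **Statement.** Let $b_i,c_i\in\mathbb R$ for $i=1,\dots,n$. The polynomials $P^{b_i,c_i}_k$ exist and are unique. The state $\varphi^{b_i,c_i}$ exists, and is then unique, if and only if $c_i\ge-1$. Let all $c_i\ge -1$. Then the free product $\varphi$ of $\varphi^{b_1,c_1},\dots,\varphi^{b_n,c_n}$ exists, is unique, and is a free Meixner state; it is faithful if and only if all $c_i>-1$. With $R_i$ the free cumulant generating function of $\varphi^{b_i,c_i}$, which satisfies (1) for $b_i,c_i$, the free cumulant generating function of $\varphi$ is $R(\mathbf z)=\sum_iR_i(z_i)$, and the corresponding $\mathbf U$ is given by $U_i(\mathbf z)=(R_i(z_i)/z_i)^{\langle-1\rangle}$. The free Sheffer polynomials $P_u$ of $\varphi$ exist, are unique, are orthogonal with respect to $\varphi$, and satisfy, for all words $\vec u$ and all $i\neq j$, $$x_iP_\emptyset=P_{(i)},\qquad x_iP_{(j,\vec u)}=P_{(i,j,\vec u)},\qquad x_iP_{(i)}=P_{(i,i)}+b_iP_{(i)}+P_\emptyset,$$ $$x_iP_{(i,j,\vec u)}=P_{(i,i,j,\vec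 u)}+b_iP_{(i,j,\vec u)}+P_{(j,\vec u)},$$ $$x_iP_{(i,i,\vec u)}=P_{(i,i,i,\vec u)}+b_iP_{(i,i,\vec u)}+(1+c_i)P_{(i,\vec u)}.$$ Moreover, whenever $x_{\vec u}=x_{v(1)}^{i(1)}x_{v(2)}^{i(2)}\cdots x_{v(k)}^{i(k)}$ with $k\ge0$, all $i(j)\ge1$ and $v(j)\ne v(j+1)$ for $1\le j<k$, $$P_{\vec u}(\mathbf x)=\prod_{j=1}^kP^{b_{v(j)},c_{v(j)}}_{i(j)}(x_{v(j)})$$ (the product taken in this order). -/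

import Mathlib

namespace FreeMeixner

/-! ### Formal power series in non-commuting indeterminates

A series in `z_1, …, z_n` with coefficients in `A` is its family of coefficients, indexed by
words in the letters `1, …, n`; the indeterminates commute with the coefficients. -/

/-- Formal power series in `n` non-commuting indeterminates with coefficients in `A`:
`f w` is the coefficient of the monomial `z_w`. -/
def NCSeries (n : ℕ) (A : Type) : Type := List (Fin n) → A

namespace NCSeries

variable {n : ℕ} {A : Type}

/-- The series with the given coefficients. -/
def mk (f : List (Fin n) → A) : NCSeries n A := f

theorem ext {f g : NCSeries n A} (h : ∀ w, f w = g w) : f = g := funext h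

theorem mk_apply (f : List (Fin n) → A) (w : List (Fin n)) : mk f w = f w := rfl

variable [Ring A]

instance : AddCommGroup (NCSeries n A) := inferInstanceAs (AddCommGroup (List (Fin n) → A))

/-- The series `1`. -/
instance : One (NCSeries n A) := ⟨mk fun w => if w = [] then 1 else 0⟩

/-- The Cauchy (concatenation) product: the coefficient at `w` sums over all ways to cut `w`
into a prefix and a suffix. -/
instance : Mul (NCSeries n A) :=
  ⟨fun f g => mk fun w => ∑ k ∈ Finset.range (w.length + 1), f (w.take k) * g (w.drop k)⟩

theorem add_apply (f g : NCSeries n A) (w : List (Fin n)) : (f + g) w = f w + g w := rfl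

theorem zero_apply (w : List (Fin n)) : (0 : NCSeries n A) w = 0 := rfl

theorem one_apply (w : List (Fin n)) : (1 : NCSeries n A) w = if w = [] then 1 else 0 := rfl

theorem mul_apply (f g : NCSeries n A) (w : List (Fin n)) :
    (f * g) w = ∑ k ∈ Finset.range (w.length + 1), f (w.take k) * g (w.drop k) := rfl

theorem mul_nil (f g : NCSeries n A) : (f * g) [] = f [] * g [] := by
  simp [mul_apply]

theorem mul_cons (f g : NCSeries n A) (a : Fin n) (w : List (Fin n)) :
    (f * g) (a :: w) = f [] * g (a :: w) + (mk (fun v => f (a :: v)) * g) w := by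
  rw [mul_apply, mul_apply, List.length_cons, Finset.sum_range_succ', add_comm]
  simp [mk_apply]

protected theorem right_distrib' (f g h : NCSeries n A) : (f + g) * h = f * h + g * h := by
  refine ext fun w => ?_
  simp only [mul_apply, add_apply, add_mul, Finset.sum_add_distrib]

protected theorem left_distrib' (f g h : NCSeries n A) : f * (g + h) = f * g + f * h := by
  refine ext fun w => ?_
  simp only [mul_apply, add_apply, mul_add, Finset.sum_add_distrib]

protected theorem zero_mul' (f : NCSeries n A) : 0 * f = 0 := by
  refine ext fun w => ?_
  simp [mul_apply, zero_apply]

protected theorem mul_zero' (f : NCSeries n A) : f * 0 = 0 := by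
  refine ext fun w => ?_
  simp [mul_apply, zero_apply]

protected theorem one_mul' (f : NCSeries n A) : 1 * f = f := by
  refine ext fun w => ?_
  cases w with
  | nil => simp [mul_nil, one_apply]
  | cons a w =>
    rw [mul_cons]
    have h : mk (fun v => (1 : NCSeries n A) (a :: v)) = 0 :=
      ext fun v => by simp [mk_apply, one_apply, zero_apply]
    rw [h, NCSeries.zero_mul']
    simp [one_apply, zero_apply]

protected theorem mul_one' (f : NCSeries n A) : f * 1 = f := by
  refine ext fun w => ?_
  induction w generalizing f with
  | nil => simp [mul_nil, one_apply]
  | cons a w ih =>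
    rw [mul_cons, ih]
    simp [one_apply, mk_apply]

protected theorem smul_mul_aux (r : A) (f g : NCSeries n A) (w : List (Fin n)) :
    (mk (fun v => r * f v) * g) w = r * (f * g) w := by
  simp only [mul_apply, mk_apply, Finset.mul_sum, mul_assoc]

protected theorem mul_assoc' (f g h : NCSeries n A) : f * g * h = f * (g * h) := by
  refine ext fun w => ?_
  induction w generalizing f g with
  | nil => simp [mul_nil, mul_assoc]
  | cons a w ih =>
    have e : mk (fun v => (f * g) (a :: v)) =
        mk (fun v => f [] * mk (fun t => g (a :: t)) v) + mk (fun v => f (a :: v)) * g :=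
      ext fun v => by rw [mk_apply, mul_cons, add_apply, mk_apply, mk_apply]
    rw [mul_cons, mul_cons f, e, NCSeries.right_distrib', add_apply, ih, mul_nil, mul_cons g,
      NCSeries.smul_mul_aux, mul_add, mul_assoc, add_assoc]

instance : Ring (NCSeries n A) where
  __ := (inferInstance : AddCommGroup (NCSeries n A))
  left_distrib := NCSeries.left_distrib'
  right_distrib := NCSeries.right_distrib'
  zero_mul := NCSeries.zero_mul'
  mul_zero := NCSeries.mul_zero'
  mul_assoc := NCSeries.mul_assoc'
  one_mul := NCSeries.one_mul'
  mul_one := NCSeries.mul_one'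

end NCSeries

/-- The indeterminate `z_i`. -/
def ncVar {n : ℕ} (i : Fin n) : NCSeries n ℝ :=
  NCSeries.mk fun w => if w = [i] then 1 else 0

/-- The composition `F(V_1, …, V_n)`, for series `V_i` without constant term: the coefficient at
`w` is `∑_u F_u · (V_{u(1)} ⋯ V_{u(k)})_w`, where only the words `u` of length at most `|w|`
contribute. -/
noncomputable def ncComp {n : ℕ} (F : NCSeries n ℝ) (V : Fin n → NCSeries n ℝ) : NCSeries n ℝ :=
  NCSeries.mk fun w => ∑ k ∈ Finset.range (w.length + 1), ∑ u : Fin k → Fin n,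
    F (List.ofFn u) * ((List.ofFn u).map V).prod w

/-- The left partial derivative `D_i`: `D_i (z_j z_u) = δ_{ij} z_u` and `D_i 1 = 0`. -/
def leftDeriv {n : ℕ} (i : Fin n) (F : NCSeries n ℝ) : NCSeries n ℝ :=
  NCSeries.mk fun w => F (i :: w)

/-- The series `f(z_i)` in non-commuting indeterminates, for a one-variable series `f`. -/
noncomputable def inVar {n : ℕ} (i : Fin n) (f : PowerSeries ℝ) : NCSeries n ℝ :=
  NCSeries.mk fun w => if w = List.replicate w.length i then PowerSeries.coeff w.length f else 0

/-! ### Functionals on non-commutative polynomials -/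

/-- Polynomials in the non-commuting variables `x_1, …, x_n`. The involution `star` reverses
monomials and fixes the variables. -/
abbrev NCPoly (n : ℕ) : Type := FreeAlgebra ℝ (Fin n)

/-- The variable `x_i`. -/
noncomputable def xVar {n : ℕ} (i : Fin n) : NCPoly n := FreeAlgebra.ι ℝ i

/-- The monomial `x_u = x_{u(1)} ⋯ x_{u(k)}`. -/
noncomputable def xMon {n : ℕ} (u : List (Fin n)) : NCPoly n := (u.map xVar).prod

/-- A state: a unital positive linear functional. -/
def IsState {n : ℕ} (φ : NCPoly n →ₗ[ℝ] ℝ) : Prop :=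
  φ 1 = 1 ∧ ∀ S : NCPoly n, 0 ≤ φ (star S * S)

/-- `φ[S* S] = 0` only for `S = 0`. -/
def IsFaithful {n : ℕ} (φ : NCPoly n →ₗ[ℝ] ℝ) : Prop :=
  ∀ S : NCPoly n, φ (star S * S) = 0 → S = 0

/-- The moment generating function `M(z) = ∑_{|u| ≥ 1} φ[x_u] z_u`. -/
noncomputable def momentSeries {n : ℕ} (φ : NCPoly n →ₗ[ℝ] ℝ) : NCSeries n ℝ :=
  NCSeries.mk fun w => if w = [] then 0 else φ (xMon w)

/-- `R` is the free cumulant generating function of `φ`: it has no constant term and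
`R(w_1 (1 + M(w)), …, w_n (1 + M(w))) = M(w)`. -/
def IsFreeCumulantSeries {n : ℕ} (φ : NCPoly n →ₗ[ℝ] ℝ) (R : NCSeries n ℝ) : Prop :=
  R [] = 0 ∧ ncComp R (fun i => ncVar i * (1 + momentSeries φ)) = momentSeries φ

/-! ### Free Sheffer polynomials and free Meixner states -/

/-- `U` is the inverse under composition of the left gradient of `R`: `(D_i R)(U(z)) = z_i`. -/
def IsGradInverse {n : ℕ} (R : NCSeries n ℝ) (U : Fin n → NCSeries n ℝ) : Prop :=
  ∀ i, U i [] = 0 ∧ ncComp (leftDeriv i R) U = ncVar i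

/-- The series `1 - x · U(z) + R(U(z))`, with coefficients in the polynomials in `x`. -/
noncomputable def shefferDenom {n : ℕ} (R : NCSeries n ℝ) (U : Fin n → NCSeries n ℝ) :
    NCSeries n (NCPoly n) :=
  1 - NCSeries.mk (fun w => ∑ i, xVar i * algebraMap ℝ (NCPoly n) (U i w)) +
    NCSeries.mk (fun w => algebraMap ℝ (NCPoly n) (ncComp R U w))

/-- `∑_u P_u(x) z_u = (1 - x · U(z) + R(U(z)))⁻¹`. -/
def HasShefferGenFun {n : ℕ} (R : NCSeries n ℝ) (U : Fin n → NCSeries n ℝ)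
    (P : NCSeries n (NCPoly n)) : Prop :=
  P * shefferDenom R U = 1 ∧ shefferDenom R U * P = 1

/-- `P` is the family of free Sheffer polynomials of the functional `φ`: the one with
generating function `(1 - x · U(z) + R(U(z)))⁻¹`, where `R` is the free cumulant generating
function of `φ` and `U` is the inverse under composition of its left gradient. -/
def IsFreeSheffer {n : ℕ} (φ : NCPoly n →ₗ[ℝ] ℝ) (P : List (Fin n) → NCPoly n) : Prop :=
  ∃ (R : NCSeries n ℝ) (U : Fin n → NCSeries n ℝ),
    IsFreeCumulantSeries φ R ∧ IsGradInverse R U ∧ HasShefferGenFun R U (NCSeries.mk P)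

/-- Orthogonality of a polynomial family with respect to `φ`. -/
def IsOrthogonal {n : ℕ} (φ : NCPoly n →ₗ[ℝ] ℝ) (P : List (Fin n) → NCPoly n) : Prop :=
  ∀ u v : List (Fin n), u ≠ v → φ (star (P u) * P v) = 0

/-- A free Meixner state: a state, centered with unit covariance, whose free Sheffer polynomials
are orthogonal. -/
def IsFreeMeixnerState {n : ℕ} (φ : NCPoly n →ₗ[ℝ] ℝ) : Prop :=
  IsState φ ∧ (∀ i, φ (xVar i) = 0) ∧
    (∀ i j, φ (xVar i * xVar j) = if i = j then 1 else 0) ∧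
    ∃ P : List (Fin n) → NCPoly n, IsFreeSheffer φ P ∧ IsOrthogonal φ P

/-! ### One variable -/

/-- A state on `ℝ[x]`. -/
def IsState₁ (ψ : Polynomial ℝ →ₗ[ℝ] ℝ) : Prop :=
  ψ 1 = 1 ∧ ∀ S : Polynomial ℝ, 0 ≤ ψ (S * S)

/-- The moment generating function `M(z) = ∑_{k ≥ 1} ψ[x^k] z^k`. -/
noncomputable def momentSeries₁ (ψ : Polynomial ℝ →ₗ[ℝ] ℝ) : PowerSeries ℝ :=
  PowerSeries.mk fun k => if k = 0 then 0 else ψ (Polynomial.X ^ k)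

/-- `R` is the free cumulant generating function of `ψ`: it has no constant term and
`R(w (1 + M(w))) = M(w)`. -/
def IsFreeCumulantSeries₁ (ψ : Polynomial ℝ →ₗ[ℝ] ℝ) (R : PowerSeries ℝ) : Prop :=
  PowerSeries.coeff 0 R = 0 ∧
    PowerSeries.subst (PowerSeries.X * (1 + momentSeries₁ ψ) : PowerSeries ℝ) R = momentSeries₁ ψ

/-- `f(z)/z`, for a series `f` without constant term. -/
noncomputable def divVar (f : PowerSeries ℝ) : PowerSeries ℝ :=
  PowerSeries.mk fun k => PowerSeries.coeff (k + 1) f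

/-- `R(z)/z² = 1 + β R(z)/z + γ (R(z)/z)²`, as an equation between power series (so `R(z)` is
divisible by `z²`). -/
def MeixnerEquation (β γ : ℝ) (R : PowerSeries ℝ) : Prop :=
  PowerSeries.coeff 0 R = 0 ∧ PowerSeries.coeff 1 R = 0 ∧
    divVar (divVar R) = 1 + PowerSeries.C β * divVar R + PowerSeries.C γ * divVar R ^ 2

/-- `V` is the inverse under composition of `R(z)/z`. -/
def IsDivInverse₁ (R V : PowerSeries ℝ) : Prop :=
  PowerSeries.coeff 0 V = 0 ∧ PowerSeries.subst V (divVar R) = (PowerSeries.X : PowerSeries ℝ)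

/-- `ψ` is the one-dimensional free Meixner state `φ^{β,γ}`: the state on `ℝ[x]` whose free
cumulant generating function satisfies the above equation. -/
def IsFreeMeixnerState₁ (β γ : ℝ) (ψ : Polynomial ℝ →ₗ[ℝ] ℝ) : Prop :=
  IsState₁ ψ ∧ ∃ R : PowerSeries ℝ, IsFreeCumulantSeries₁ ψ R ∧ MeixnerEquation β γ R

/-- `p` is the family of one-variable free Meixner polynomials `P_k^{β,γ}`:
`∑_k P_k(x) z^k = (1 - x U(z) + R(U(z)))⁻¹`, where `R` satisfies the above equation and `U` is
the inverse under composition of `R(z)/z`. -/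
def IsFreeMeixnerPolynomials (β γ : ℝ) (p : ℕ → Polynomial ℝ) : Prop :=
  ∃ R U : PowerSeries ℝ, MeixnerEquation β γ R ∧ IsDivInverse₁ R U ∧
    PowerSeries.mk p *
      (1 - PowerSeries.C (Polynomial.X : Polynomial ℝ) * PowerSeries.map Polynomial.C U +
        PowerSeries.map Polynomial.C (PowerSeries.subst U R : PowerSeries ℝ)) = 1

/-! ### Free products -/

/-- `φ` is the free product of the functionals `ψ_1, …, ψ_n`: the unital functional whose mixed
free cumulants are zero, and with `R_φ[x_i^k] = R_{ψ_i}[x^k]`. -/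
def IsFreeProduct {n : ℕ} (ψ : Fin n → (Polynomial ℝ →ₗ[ℝ] ℝ)) (φ : NCPoly n →ₗ[ℝ] ℝ) : Prop :=
  φ 1 = 1 ∧ ∃ (R : NCSeries n ℝ) (r : Fin n → PowerSeries ℝ),
    IsFreeCumulantSeries φ R ∧ (∀ i, IsFreeCumulantSeries₁ (ψ i) (r i)) ∧
    (∀ u : List (Fin n), (¬ ∃ i, ∀ j ∈ u, j = i) → R u = 0) ∧
    ∀ (i : Fin n) (k : ℕ), R (List.replicate k i) = PowerSeries.coeff k (r i)

end FreeMeixner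

/-! Write `S_i = R_i(z)/z`. Equation (1) says `S_i = (1 + b_i S_i + c_i S_i²) z`, so the
compositional inverse of `S_i` is `V_i = z/(1 + b_i z + c_i z²)`, and `R_i(V_i) = z V_i`. For `R = ∑
R_i(z_i)` the left gradient is `S_i(z_i)`, hence `U_i = V_i(z_i)`, and the Sheffer denominator is `1
- ∑ V_i(z_i)(x_i - z_i)`. Splitting a series `P` by first letters and clearing denominators, `P` is
its inverse as soon as `P` has constant term `1` and `(1 + b_i z_i + c_i z_i²) D_i P = (x_i - z_i)
P`; coefficientwise this is the claimed recursion. So the recursion serves as the definition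
(`meixnerPoly`), and `hasShefferGenFun_meixnerPoly` and `isFreeSheffer_iff` identify the result with
the free Sheffer polynomials. The product formula is read off from the recursion, block by block.

The recursion presents multiplication by `x_i` as creation plus diagonal plus annihilation,
symmetric for the inner product in which `P_u` has squared norm `weight c u`. Once `φ[P_w] = 0` for
nonempty `w`, induction gives `φ[P_u* P_v] = δ_{uv} weight c u` (`functional_star_mul`). The
vanishing is where the cumulants enter: with `G = 1 + M` and `T_i = S_i(z_i G)` one has `M = (∑ T_i
z_i) G`, and constant multiples of `G T_{w(k)} ⋯ T_{w(1)}` solve the recursion for the generating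
series of `φ[x_u P_w]` (`resolvent_eq`, `functional_xMon_mul`); the `T_i` have no constant term.

Hence `φ[S* S] = ∑ a_u² weight c u`. The weights are products of factors `1` and `1 + c_i`, which
gives positivity and the faithfulness criterion; the squared norm `1 + c_i` of `P_{(i,i)}` gives the
necessity of `c_i ≥ -1`. The one-dimensional states are the case `n = 1`. Existence and uniqueness
of moments, cumulants and inverses come from contractions in the filtration by word length. -/

namespace FreeMeixner

/-! ### The algebra of non-commutative series -/

namespace NCSeries

section

variable {n : ℕ} {A : Type}

theorem ext_cons {f g : NCSeries n A} (h0 : f [] = g []) (h : ∀ i w, f (i :: w) = g (i :: w)) :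
    f = g :=
  ext fun w => by cases w with
    | nil => exact h0
    | cons i w => exact h i w

/-- The two series have the same coefficients at words of length less than `N`. -/
def EqBelow (N : ℕ) (f g : NCSeries n A) : Prop :=
  ∀ w : List (Fin n), w.length < N → f w = g w

/-- The filtration by word length is separated, so a map that improves agreement by one degree has
at most one fixed point. -/
theorem fixedPoint_unique (T : NCSeries n A → NCSeries n A)
    (hT : ∀ N f g, EqBelow N f g → EqBelow (N + 1) (T f) (T g)) {f g : NCSeries n A}
    (hf : T f = f) (hg : T g = g) : f = g := by
  have key : ∀ N, EqBelow N f g := by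
    intro N
    induction N with
    | zero => exact fun w hw => by simp at hw
    | succ N ih => rw [← hf, ← hg]; exact hT _ _ _ ih
  exact ext fun w => key (w.length + 1) w (Nat.lt_succ_self _)

end

section Ring

variable {n : ℕ} {A : Type} [Ring A]

theorem sub_apply (f g : NCSeries n A) (w : List (Fin n)) : (f - g) w = f w - g w := rfl

theorem sum_apply {ι : Type} (s : Finset ι) (f : ι → NCSeries n A) (w : List (Fin n)) :
    (∑ i ∈ s, f i) w = ∑ i ∈ s, f i w := by
  classical
  induction s using Finset.induction_on with
  | empty => simp [zero_apply]
  | insert a s ha ih => rw [Finset.sum_insert ha, Finset.sum_insert ha, add_apply, ih]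

/-- The constant series. -/
def const : A →+* NCSeries n A where
  toFun a := mk fun w => if w = [] then a else 0
  map_one' := rfl
  map_zero' := ext fun w => by simp [mk_apply, zero_apply]
  map_add' a b := ext fun w => by
    rw [add_apply, mk_apply, mk_apply, mk_apply]
    split_ifs <;> simp
  map_mul' a b := ext fun w => by
    cases w with
    | nil => simp [mul_nil, mk_apply]
    | cons i w =>
      rw [mul_apply, mk_apply, if_neg (by simp), Finset.sum_eq_zero]
      intro k _
      rcases Nat.eq_zero_or_pos k with rfl | hk
      · simp [mk_apply]
      · simp [mk_apply, hk.ne']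

theorem const_apply (a : A) (w : List (Fin n)) :
    const a w = if w = [] then a else 0 := rfl

theorem const_mul_apply (a : A) (f : NCSeries n A) (w : List (Fin n)) :
    (const a * f : NCSeries n A) w = a * f w := by
  rw [mul_apply, Finset.sum_eq_single 0]
  · simp [const_apply]
  · intro k hk hk0
    rw [const_apply, if_neg, zero_mul]
    intro h
    rw [Finset.mem_range] at hk
    have := congrArg List.length h
    simp at this
    rcases this with h' | h'
    · exact hk0 h'
    · subst h'; simp at hk; exact hk0 hk
  · simp

theorem mul_const_apply (a : A) (f : NCSeries n A) (w : List (Fin n)) :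
    (f * const a : NCSeries n A) w = f w * a := by
  rw [mul_apply, Finset.sum_eq_single w.length]
  · simp [const_apply]
  · intro k hk hk0
    rw [const_apply, if_neg, mul_zero]
    intro h
    rw [Finset.mem_range] at hk
    have := congrArg List.length h
    simp at this
    omega
  · simp

theorem const_commute {a : A} (ha : ∀ b : A, Commute a b) (f : NCSeries n A) :
    Commute (const a) f :=
  ext fun w => by rw [const_mul_apply, mul_const_apply]; exact ha _

/-- The series `z_i`. -/
def var (i : Fin n) : NCSeries n A := mk fun w => if w = [i] then 1 else 0

theorem var_apply (i : Fin n) (w : List (Fin n)) :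
    (var i : NCSeries n A) w = if w = [i] then 1 else 0 := rfl

theorem var_mul_nil (i : Fin n) (f : NCSeries n A) : (var i * f : NCSeries n A) [] = 0 := by
  simp [mul_nil, var_apply]

theorem var_mul_cons (i j : Fin n) (f : NCSeries n A) (w : List (Fin n)) :
    (var i * f : NCSeries n A) (j :: w) = if j = i then f w else 0 := by
  have h : mk (fun v => (var i : NCSeries n A) (j :: v)) = const (if j = i then 1 else 0) :=
    ext fun v => by
      rw [mk_apply, var_apply, const_apply]
      by_cases hj : j = i <;> by_cases hv : v = [] <;> simp [hj, hv]
  rw [mul_cons, h, const_mul_apply, var_apply]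
  by_cases hj : j = i <;> simp [hj]

theorem mul_var_concat (i j : Fin n) (f : NCSeries n A) (w : List (Fin n)) :
    (f * var i : NCSeries n A) (w ++ [j]) = if j = i then f w else 0 := by
  rw [mul_apply, Finset.sum_eq_single w.length]
  · by_cases hj : j = i <;> simp [var_apply, hj]
  · intro k hk hk0
    rw [var_apply, if_neg, mul_zero]
    intro h
    have := congrArg List.length h
    simp at this hk
    omega
  · simp

/-- A series splits according to the first letter. -/
theorem eq_const_add_sum (f : NCSeries n A) :
    f = const (f []) + ∑ i, var i * mk fun w => f (i :: w) := by
  refine ext_cons ?_ fun i w => ?_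
  · simp [add_apply, const_apply, sum_apply, var_mul_nil]
  · simp [add_apply, const_apply, sum_apply, var_mul_cons, mk_apply]

theorem EqBelow.mul {N : ℕ} {f f' g g' : NCSeries n A} (hf : EqBelow N f f')
    (hg : EqBelow N g g') : EqBelow N (f * g) (f' * g') := by
  intro w hw
  rw [mul_apply, mul_apply]
  refine Finset.sum_congr rfl fun k hk => ?_
  rw [hf _ (by simp; omega), hg _ (by simp; omega)]

theorem EqBelow.mul_left {N : ℕ} {f g g' : NCSeries n A} (hf : f [] = 0)
    (hg : EqBelow N g g') : EqBelow (N + 1) (f * g) (f * g') := by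
  intro w hw
  rw [mul_apply, mul_apply]
  refine Finset.sum_congr rfl fun k hk => ?_
  rcases Nat.eq_zero_or_pos k with rfl | hk0
  · simp [hf]
  · rw [Finset.mem_range] at hk
    rw [hg _ (by simp; omega)]

theorem EqBelow.listProd {N : ℕ} {V V' : Fin n → NCSeries n A}
    (h : ∀ i, EqBelow N (V i) (V' i)) (u : List (Fin n)) :
    EqBelow N (u.map V).prod (u.map V').prod := by
  induction u with
  | nil => exact fun w _ => rfl
  | cons i u ih =>
    rw [List.map_cons, List.map_cons, List.prod_cons, List.prod_cons]
    exact (h i).mul ih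

/-- Each factor without constant term uses up at least one letter. This makes the truncated sum in
`ncComp` the full composition. -/
theorem listProd_apply_eq_zero {V : Fin n → NCSeries n A} (hV : ∀ i, V i [] = 0)
    (u w : List (Fin n)) (h : w.length < u.length) : (u.map V).prod w = 0 := by
  induction u generalizing w with
  | nil => simp at h
  | cons i u ih =>
    rw [List.map_cons, List.prod_cons, mul_apply]
    refine Finset.sum_eq_zero fun k hk => ?_
    rw [Finset.mem_range] at hk
    rcases Nat.eq_zero_or_pos k with rfl | hk0
    · simp [hV]
    · rw [ih _ (by simp at h ⊢; omega), mul_zero]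

/-- A family of series with `X_a = ∑_i V_i X_{d_i(a)}`, where the `V_i` have no constant term,
is zero. -/
theorem eq_zero_of_recursion {ι : Type} {V : Fin n → NCSeries n A} (hV : ∀ i, V i [] = 0)
    (X : ι → NCSeries n A) (d : Fin n → ι → ι) (h : ∀ a, X a = ∑ i, V i * X (d i a)) (a : ι) :
    X a = 0 := by
  have key : ∀ N : ℕ, ∀ a, EqBelow N (X a) 0 := by
    intro N
    induction N with
    | zero => exact fun a w hw => by simp at hw
    | succ N ih =>
      intro a w hw
      rw [h a, sum_apply]
      refine Finset.sum_eq_zero fun i _ => ?_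
      rw [EqBelow.mul_left (hV i) (ih (d i a)) w hw, mul_zero, zero_apply]
  exact ext fun w => key (w.length + 1) a w (Nat.lt_succ_self _)

/-- A contraction in the length filtration has a fixed point. -/
theorem exists_fixedPoint (T : NCSeries n A → NCSeries n A)
    (hT : ∀ N f g, EqBelow N f g → EqBelow (N + 1) (T f) (T g)) : ∃ f, T f = f := by
  have h1 : ∀ N, EqBelow N (T^[N] 0) (T^[N + 1] 0) := by
    intro N
    induction N with
    | zero => exact fun w hw => by simp at hw
    | succ N ih =>
      rw [Function.iterate_succ_apply', Function.iterate_succ_apply' (n := N + 1)]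
      exact hT _ _ _ ih
  have h2 : ∀ N M, N ≤ M → EqBelow N (T^[N] 0) (T^[M] 0) := by
    intro N M hNM
    induction M, hNM using Nat.le_induction with
    | base => exact fun w _ => rfl
    | succ M hM ih => exact fun w hw => (ih w hw).trans (h1 M w (by omega))
  -- The iterates of `0` stabilise: from iterate `w.length + 1` on, the coefficient at `w` no longer
  -- changes.
  refine ⟨mk fun w => T^[w.length + 1] 0 w, ext fun w => ?_⟩
  have h3 : EqBelow w.length (mk fun w => T^[w.length + 1] 0 w) (T^[w.length] 0) :=
    fun v hv => h2 _ _ hv v (Nat.lt_succ_self _)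
  rw [hT _ _ _ h3 w (Nat.lt_succ_self _), mk_apply, Function.iterate_succ_apply']

/-- A series with constant term `1` is invertible. -/
theorem isUnit_of_nil_eq_one (f : NCSeries n A) (hf : f [] = 1) : IsUnit f := by
  have right : ∀ f : NCSeries n A, f [] = 1 → ∃ g, g [] = 1 ∧ f * g = 1 := by
    intro f hf
    have h0 : (1 - f) [] = 0 := by rw [sub_apply, hf, one_apply, if_pos rfl, sub_self]
    -- A right inverse of `f` is a fixed point of `g ↦ 1 + (1 - f) g`, a contraction because `1 - f`
    -- has no constant term.
    obtain ⟨g, hg⟩ := exists_fixedPoint (fun g => 1 + (1 - f) * g) fun N g g' h w hw => by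
      rw [add_apply, add_apply, EqBelow.mul_left h0 h w hw]
    refine ⟨g, ?_, ?_⟩
    · rw [← hg, add_apply, mul_nil, h0, zero_mul, add_zero, one_apply, if_pos rfl]
    · have : g = 1 + (g - f * g) := by
        conv_lhs => rw [← hg]
        rw [sub_mul, one_mul]
      have h2 : f * g = 1 + (g - g) + (f * g - f * g) := by
        calc f * g = g - (g - f * g) := by abel
          _ = 1 + (g - f * g) - (g - f * g) := by rw [← this]
          _ = _ := by abel
      simpa using h2
  -- The right inverse `g` again has constant term `1`, hence a right inverse of its own, which can
  -- only be `f`.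
  obtain ⟨g, hg0, hg⟩ := right f hf
  obtain ⟨h, -, hh⟩ := right g hg0
  have : f = h := by rw [← mul_one f, ← hh, ← mul_assoc, hg, one_mul]
  exact ⟨⟨f, g, hg, by rw [this]; exact hh⟩, rfl⟩

end Ring

section Map

variable {n : ℕ} {A B : Type} [Ring A] [Ring B]

/-- The map induced on series by a ring homomorphism of the coefficients. -/
def map (h : A →+* B) : NCSeries n A →+* NCSeries n B where
  toFun f := mk fun w => h (f w)
  map_one' := ext fun w => by rw [mk_apply, one_apply, one_apply]; split_ifs <;> simp
  map_zero' := ext fun w => by rw [mk_apply, zero_apply, zero_apply, map_zero]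
  map_add' f g := ext fun w => by simp only [mk_apply, add_apply, map_add]
  map_mul' f g := ext fun w => by simp only [mk_apply, mul_apply, map_sum, map_mul]

theorem map_apply (h : A →+* B) (f : NCSeries n A) (w : List (Fin n)) :
    map h f w = h (f w) := rfl

theorem map_var (h : A →+* B) (i : Fin n) : map h (var i : NCSeries n A) = var i :=
  ext fun w => by rw [map_apply, var_apply, var_apply]; split_ifs <;> simp

theorem map_const (h : A →+* B) (a : A) : map h (const a : NCSeries n A) = const (h a) :=
  ext fun w => by rw [map_apply, const_apply, const_apply]; split_ifs <;> simp

end Map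

theorem const_mul_comm {n : ℕ} (a : ℝ) (f : NCSeries n ℝ) : const a * f = f * const a :=
  const_commute (fun b => Commute.all a b) f

end NCSeries

open NCSeries

/-! ### Composition of non-commutative series. -/

section Comp

variable {n : ℕ}

theorem ncVar_eq_var (i : Fin n) : ncVar i = (var i : NCSeries n ℝ) := rfl

theorem leftDeriv_apply (i : Fin n) (F : NCSeries n ℝ) (w : List (Fin n)) :
    leftDeriv i F w = F (i :: w) := rfl

theorem leftDeriv_const (i : Fin n) (a : ℝ) : leftDeriv i (const a : NCSeries n ℝ) = 0 :=
  NCSeries.ext fun w => by simp [leftDeriv_apply, const_apply, NCSeries.zero_apply]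

theorem leftDeriv_var_mul (i j : Fin n) (F : NCSeries n ℝ) :
    leftDeriv i (var j * F) = if i = j then F else 0 :=
  NCSeries.ext fun w => by
    rw [leftDeriv_apply, var_mul_cons]
    split_ifs <;> rfl

theorem leftDeriv_mul (i : Fin n) (F G : NCSeries n ℝ) :
    leftDeriv i (F * G) = const (F []) * leftDeriv i G + leftDeriv i F * G :=
  NCSeries.ext fun w => by
    rw [leftDeriv_apply, mul_cons, NCSeries.add_apply, const_mul_apply]
    rfl

theorem ncComp_apply_of_lt (F : NCSeries n ℝ) {V : Fin n → NCSeries n ℝ}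
    (hV : ∀ i, V i [] = 0) (w : List (Fin n)) (N : ℕ) (h : w.length < N) :
    ncComp F V w = ∑ k ∈ Finset.range N, ∑ u : Fin k → Fin n,
      F (List.ofFn u) * ((List.ofFn u).map V).prod w := by
  refine Finset.sum_subset (Finset.range_subset_range.2 h) fun k _ hk => ?_
  refine Finset.sum_eq_zero fun u _ => ?_
  rw [listProd_apply_eq_zero hV, mul_zero]
  simp at hk ⊢
  omega

theorem ncComp_add (F G : NCSeries n ℝ) (V : Fin n → NCSeries n ℝ) :
    ncComp (F + G) V = ncComp F V + ncComp G V :=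
  NCSeries.ext fun w => by
    rw [NCSeries.add_apply]
    simp only [ncComp, mk_apply, NCSeries.add_apply, add_mul, Finset.sum_add_distrib]

theorem ncComp_const_mul (a : ℝ) (F : NCSeries n ℝ) (V : Fin n → NCSeries n ℝ) :
    ncComp (const a * F) V = const a * ncComp F V :=
  NCSeries.ext fun w => by
    rw [const_mul_apply]
    simp only [ncComp, mk_apply, const_mul_apply, Finset.mul_sum, mul_assoc]

/-- Composition, computed through the first letter. -/
theorem ncComp_eq (F : NCSeries n ℝ) {V : Fin n → NCSeries n ℝ} (hV : ∀ i, V i [] = 0) :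
    ncComp F V = const (F []) + ∑ i, V i * ncComp (leftDeriv i F) V := by
  refine NCSeries.ext fun w => ?_
  rw [NCSeries.add_apply, NCSeries.sum_apply, ncComp_apply_of_lt F hV w (w.length + 1)
    (Nat.lt_succ_self _), Finset.sum_range_succ', add_comm]
  congr 1
  · simp [NCSeries.one_apply, const_apply]
  · have h1 : ∀ (i : Fin n), (V i * ncComp (leftDeriv i F) V) w =
        ∑ k ∈ Finset.range w.length, ∑ u : Fin k → Fin n,
          F (i :: List.ofFn u) * (V i * ((List.ofFn u).map V).prod) w := by
      intro i
      have h2 : ∀ m ∈ Finset.range (w.length + 1),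
          V i (w.take m) * ncComp (leftDeriv i F) V (w.drop m) =
          ∑ k ∈ Finset.range w.length, ∑ u : Fin k → Fin n, F (i :: List.ofFn u) *
            (V i (w.take m) * ((List.ofFn u).map V).prod (w.drop m)) := by
        intro m hm
        rw [Finset.mem_range] at hm
        -- The empty prefix contributes nothing, and any other leaves a suffix shorter than `w`; so
        -- one range of degrees serves all cuts.
        rcases Nat.eq_zero_or_pos m with rfl | hm0
        · simp [hV]
        · rw [ncComp_apply_of_lt _ hV _ w.length (by simp; omega), Finset.mul_sum]
          refine Finset.sum_congr rfl fun k _ => ?_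
          rw [Finset.mul_sum]
          refine Finset.sum_congr rfl fun u _ => ?_
          rw [leftDeriv_apply]
          ring
      rw [NCSeries.mul_apply, Finset.sum_congr rfl h2, Finset.sum_comm]
      refine Finset.sum_congr rfl fun k _ => ?_
      rw [Finset.sum_comm]
      refine Finset.sum_congr rfl fun u _ => ?_
      rw [NCSeries.mul_apply, Finset.mul_sum]
    rw [Finset.sum_congr rfl fun i _ => h1 i, Finset.sum_comm]
    refine Finset.sum_congr rfl fun k _ => ?_
    -- A word of length `k + 1` is a first letter together with a word of length `k`.
    rw [← (Fin.consEquiv fun _ : Fin (k + 1) => Fin n).sum_comp, Fintype.sum_prod_type]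
    refine Finset.sum_congr rfl fun i _ => Finset.sum_congr rfl fun u _ => ?_
    simp [Fin.consEquiv, List.ofFn_succ]

theorem ncComp_const (a : ℝ) {V : Fin n → NCSeries n ℝ} (hV : ∀ i, V i [] = 0) :
    ncComp (const a) V = const a := by
  have h0 : ncComp (0 : NCSeries n ℝ) V = 0 := by
    have := ncComp_add 0 0 V
    simpa using this
  rw [ncComp_eq _ hV]
  simp [leftDeriv_const, h0, const_apply]

/-- By the Leibniz rule `leftDeriv_mul`, the defect `X_F = (FG)(V) - F(V) G(V)` satisfies `X_F = ∑
V_i X_{D_i F}`, so it vanishes by `eq_zero_of_recursion`. -/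
theorem ncComp_mul (F G : NCSeries n ℝ) {V : Fin n → NCSeries n ℝ} (hV : ∀ i, V i [] = 0) :
    ncComp (F * G) V = ncComp F V * ncComp G V := by
  rw [← sub_eq_zero]
  refine eq_zero_of_recursion hV (fun F => ncComp (F * G) V - ncComp F V * ncComp G V)
    leftDeriv (fun F => ?_) F
  have h : ∀ i, V i * ncComp (leftDeriv i (F * G)) V =
      const (F []) * (V i * ncComp (leftDeriv i G) V) + V i * ncComp (leftDeriv i F * G) V := by
    intro i
    rw [leftDeriv_mul, ncComp_add, ncComp_const_mul, mul_add, ← mul_assoc, ← mul_assoc,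
      const_mul_comm]
  simp only [mul_sub, Finset.sum_sub_distrib, ← mul_assoc, ← Finset.sum_mul]
  rw [ncComp_eq (F * G) hV, Finset.sum_congr rfl fun i _ => h i, Finset.sum_add_distrib,
    ← Finset.mul_sum, mul_nil, map_mul, ncComp_eq F hV, add_mul, ← add_assoc, ← mul_add,
    ← ncComp_eq G hV]
  abel

/-- Composition with `V` as a ring homomorphism. -/
noncomputable def compHom (V : Fin n → NCSeries n ℝ) (hV : ∀ i, V i [] = 0) :
    NCSeries n ℝ →+* NCSeries n ℝ where
  toFun F := ncComp F V
  map_one' := by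
    have := ncComp_const (n := n) 1 hV
    rwa [map_one] at this
  map_zero' := by
    have := ncComp_const (n := n) 0 hV
    rwa [map_zero] at this
  map_add' F G := ncComp_add F G V
  map_mul' F G := ncComp_mul F G hV

theorem compHom_apply (V : Fin n → NCSeries n ℝ) (hV : ∀ i, V i [] = 0) (F : NCSeries n ℝ) :
    compHom V hV F = ncComp F V := rfl

theorem ncComp_var (i : Fin n) {V : Fin n → NCSeries n ℝ} (hV : ∀ i, V i [] = 0) :
    ncComp (var i) V = V i := by
  have h1 : ncComp (1 : NCSeries n ℝ) V = 1 := map_one (compHom V hV)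
  have h0 : ncComp (0 : NCSeries n ℝ) V = 0 := map_zero (compHom V hV)
  have h : ∀ j, leftDeriv j (var i : NCSeries n ℝ) = if j = i then 1 else 0 := fun j => by
    have := leftDeriv_var_mul j i (1 : NCSeries n ℝ)
    rwa [mul_one] at this
  rw [ncComp_eq _ hV]
  simp only [h]
  rw [Finset.sum_eq_single i]
  · simp [h1, var_apply]
  · intro j _ hj
    simp [hj, h0]
  · simp

theorem ncComp_eqBelow (F : NCSeries n ℝ) {V V' : Fin n → NCSeries n ℝ} {N : ℕ}
    (h : ∀ i, EqBelow N (V i) (V' i)) : EqBelow N (ncComp F V) (ncComp F V') := by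
  intro w hw
  simp only [ncComp, mk_apply]
  refine Finset.sum_congr rfl fun k _ => Finset.sum_congr rfl fun u _ => ?_
  rw [EqBelow.listProd h _ w hw]

end Comp

/-! ### Series in a single indeterminate -/

section InVar

variable {n : ℕ}

theorem eq_X_mul_divVar (f : PowerSeries ℝ) (hf : PowerSeries.coeff 0 f = 0) :
    f = PowerSeries.X * divVar f := by
  conv_lhs => rw [PowerSeries.eq_X_mul_shift_add_const f]
  rw [← PowerSeries.coeff_zero_eq_constantCoeff_apply, hf, map_zero, add_zero]
  rfl

theorem eq_C_add_X_mul_divVar (f : PowerSeries ℝ) :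
    f = PowerSeries.C (PowerSeries.coeff 0 f) + PowerSeries.X * divVar f := by
  conv_lhs => rw [PowerSeries.eq_X_mul_shift_add_const f]
  rw [← PowerSeries.coeff_zero_eq_constantCoeff_apply, add_comm]
  rfl

theorem divVar_X_mul (f : PowerSeries ℝ) : divVar (PowerSeries.X * f) = f := by
  ext k
  rw [divVar, PowerSeries.coeff_mk, PowerSeries.coeff_succ_X_mul]

theorem inVar_apply (i : Fin n) (f : PowerSeries ℝ) (w : List (Fin n)) :
    inVar i f w = if w = List.replicate w.length i then PowerSeries.coeff w.length f else 0 := rfl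

theorem inVar_replicate (i : Fin n) (f : PowerSeries ℝ) (k : ℕ) :
    inVar i f (List.replicate k i) = PowerSeries.coeff k f := by
  simp [inVar_apply]

theorem inVar_nil (i : Fin n) (f : PowerSeries ℝ) : inVar i f [] = PowerSeries.coeff 0 f := by
  simp [inVar_apply]

theorem inVar_eq_zero (i : Fin n) (f : PowerSeries ℝ) {w : List (Fin n)} (h : ∃ j ∈ w, j ≠ i) :
    inVar i f w = 0 := by
  rw [inVar_apply, if_neg]
  intro hw
  obtain ⟨j, hj, hji⟩ := h
  rw [hw] at hj
  exact hji (List.eq_of_mem_replicate hj)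

theorem leftDeriv_inVar_self (i : Fin n) (f : PowerSeries ℝ) :
    leftDeriv i (inVar i f) = inVar i (divVar f) :=
  NCSeries.ext fun w => by
    simp [leftDeriv_apply, inVar_apply, divVar, List.replicate_succ]

theorem leftDeriv_inVar_of_ne {i j : Fin n} (h : i ≠ j) (f : PowerSeries ℝ) :
    leftDeriv i (inVar j f) = 0 :=
  NCSeries.ext fun w => inVar_eq_zero j f ⟨i, by simp, h⟩

theorem inVar_eq (i : Fin n) (f : PowerSeries ℝ) :
    inVar i f = const (PowerSeries.coeff 0 f) + var i * inVar i (divVar f) := by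
  refine NCSeries.ext_cons ?_ fun j w => ?_
  · rw [inVar_nil, NCSeries.add_apply, var_mul_nil, const_apply, if_pos rfl, add_zero]
  · rw [NCSeries.add_apply, var_mul_cons, const_apply, if_neg (by simp), zero_add,
      show inVar i f (j :: w) = leftDeriv j (inVar i f) w from rfl]
    split_ifs with h
    · rw [h, leftDeriv_inVar_self]
    · rw [leftDeriv_inVar_of_ne h]
      rfl

theorem inVar_cons (i j : Fin n) (f : PowerSeries ℝ) (w : List (Fin n)) :
    inVar i f (j :: w) = if j = i then inVar i (divVar f) w else 0 := by
  rw [inVar_eq, NCSeries.add_apply, var_mul_cons, const_apply, if_neg (by simp), zero_add]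

theorem inVar_add (i : Fin n) (f g : PowerSeries ℝ) :
    inVar i (f + g) = inVar i f + inVar i g :=
  NCSeries.ext fun w => by
    rw [NCSeries.add_apply, inVar_apply, inVar_apply, inVar_apply]
    split_ifs <;> simp

theorem inVar_C (i : Fin n) (a : ℝ) : inVar i (PowerSeries.C a) = const a :=
  NCSeries.ext fun w => by
    cases w with
    | nil => simp [inVar_apply, const_apply]
    | cons j w => simp [inVar_apply, const_apply]

theorem inVar_C_mul (i : Fin n) (a : ℝ) (f : PowerSeries ℝ) :
    inVar i (PowerSeries.C a * f) = const a * inVar i f :=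
  NCSeries.ext fun w => by
    rw [const_mul_apply, inVar_apply, inVar_apply]
    split_ifs <;> simp

theorem inVar_X_mul (i : Fin n) (f : PowerSeries ℝ) :
    inVar i (PowerSeries.X * f) = var i * inVar i f := by
  rw [inVar_eq, divVar_X_mul, PowerSeries.coeff_zero_X_mul, map_zero, zero_add]

/-- The one-variable counterpart of `leftDeriv_mul`; the two rules match, which proves `inVar_mul`
by induction on the word. -/
theorem divVar_mul (f g : PowerSeries ℝ) :
    divVar (f * g) = PowerSeries.C (PowerSeries.coeff 0 f) * divVar g + divVar f * g := by
  have h : f * g = PowerSeries.C (PowerSeries.coeff 0 f * PowerSeries.coeff 0 g) +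
      PowerSeries.X * (PowerSeries.C (PowerSeries.coeff 0 f) * divVar g + divVar f * g) := by
    conv_lhs => rw [eq_C_add_X_mul_divVar f, add_mul]
    conv_lhs => enter [1]; rw [eq_C_add_X_mul_divVar g]
    rw [map_mul]
    ring
  ext k
  rw [h, divVar, PowerSeries.coeff_mk, map_add, PowerSeries.coeff_succ_X_mul,
    PowerSeries.coeff_C, if_neg (by simp), zero_add]

theorem inVar_mul (i : Fin n) (f g : PowerSeries ℝ) :
    inVar i (f * g) = inVar i f * inVar i g := by
  refine NCSeries.ext fun w => ?_
  induction w generalizing f with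
  | nil => simp [mul_nil, inVar_nil, PowerSeries.coeff_mul]
  | cons j w ih =>
    have e : (inVar i f * inVar i g) (j :: w) = PowerSeries.coeff 0 f * inVar i g (j :: w) +
        (leftDeriv j (inVar i f) * inVar i g) w := by
      rw [mul_cons, inVar_nil]
      rfl
    rw [inVar_cons, divVar_mul, inVar_add, inVar_C_mul, e, inVar_cons i j g]
    split_ifs with h
    · rw [h, leftDeriv_inVar_self, NCSeries.add_apply, ih, const_mul_apply]
    · rw [leftDeriv_inVar_of_ne h, zero_mul, NCSeries.zero_apply, mul_zero, add_zero]

/-- The embedding of the one-variable series as the series in `z_i`. -/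
noncomputable def inVarHom (i : Fin n) : PowerSeries ℝ →+* NCSeries n ℝ where
  toFun := inVar i
  map_one' := by
    have := inVar_C i (1 : ℝ)
    rwa [map_one, map_one] at this
  map_zero' := by
    have := inVar_C i (0 : ℝ)
    rwa [map_zero, map_zero] at this
  map_add' := inVar_add i
  map_mul' := inVar_mul i

theorem inVarHom_apply (i : Fin n) (f : PowerSeries ℝ) : inVarHom i f = inVar i f := rfl

theorem inVar_X (i : Fin n) : inVar i PowerSeries.X = var i := by
  have := inVar_X_mul i 1
  rwa [← inVarHom_apply i 1, map_one, mul_one, mul_one] at this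

theorem inVar_one (i : Fin n) : inVar i 1 = 1 := map_one (inVarHom i)

theorem inVar_injective (i : Fin n) : Function.Injective (inVar i) := fun f g h => by
  ext k
  rw [← inVar_replicate i f, h, inVar_replicate]

/-- Composition in a single indeterminate is substitution. -/
theorem ncComp_inVar (i : Fin n) (f g : PowerSeries ℝ) (hg : PowerSeries.coeff 0 g = 0)
    {V : Fin n → NCSeries n ℝ} (hV : ∀ j, V j [] = 0) (hi : V i = inVar i g) :
    ncComp (inVar i f) V = inVar i (PowerSeries.subst g f) := by
  have hs : PowerSeries.HasSubst g := PowerSeries.HasSubst.of_constantCoeff_zero'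
    (by rw [← PowerSeries.coeff_zero_eq_constantCoeff_apply, hg])
  rw [← sub_eq_zero]
  -- Only the letter `i` matters: every other letter is sent to the series `0`, whose defect
  -- vanishes, so the sum over letters has a single term.
  refine eq_zero_of_recursion (ι := PowerSeries ℝ) (V := fun _ : Fin n => V i) (fun _ => hV i)
    (fun f => ncComp (inVar i f) V - inVar i (PowerSeries.subst g f))
    (fun j f => if j = i then divVar f else 0) (fun f => ?_) f
  have h0 : ncComp (inVar i 0) V - inVar i (PowerSeries.subst g (0 : PowerSeries ℝ)) = 0 := by
    have h1 : inVar i (0 : PowerSeries ℝ) = 0 := map_zero (inVarHom i)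
    have h2 : PowerSeries.subst g (0 : PowerSeries ℝ) = (0 : PowerSeries ℝ) := by
      rw [← PowerSeries.coe_substAlgHom hs, map_zero]
    have h3 : ncComp (0 : NCSeries n ℝ) V = 0 := map_zero (compHom V hV)
    rw [h2, h1, h3, sub_zero]
  rw [Finset.sum_eq_single i (fun j _ hj => by rw [if_neg hj, h0, mul_zero]) (by simp), if_pos rfl]
  have e : PowerSeries.subst g f = PowerSeries.C (PowerSeries.coeff 0 f) +
      g * PowerSeries.subst g (divVar f) := by
    conv_lhs => rw [eq_C_add_X_mul_divVar f]
    rw [PowerSeries.subst_add hs, PowerSeries.subst_mul hs, PowerSeries.subst_X hs,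
      PowerSeries.subst_C]
    rfl
  rw [inVar_eq i f, ncComp_add, ncComp_mul _ _ hV, ncComp_var _ hV, ncComp_const _ hV, e,
    inVar_add, inVar_mul, inVar_C, ← hi, mul_sub]
  abel

end InVar

/-! ### Moments and free cumulants -/

section Cumulants

variable {n : ℕ}

theorem ncVar_mul_nil (i : Fin n) (F : NCSeries n ℝ) : (ncVar i * F) [] = 0 := var_mul_nil i F

/-- The free cumulants determine the moments. -/
theorem moment_contraction (R : NCSeries n ℝ) (N : ℕ) (M M' : NCSeries n ℝ)
    (h : EqBelow N M M') :
    EqBelow (N + 1) (ncComp R fun i => ncVar i * (1 + M)) (ncComp R fun i => ncVar i * (1 + M')) :=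
  ncComp_eqBelow _ fun i => EqBelow.mul_left (by simp [ncVar_eq_var, var_apply]) fun w hw => by
    rw [NCSeries.add_apply, NCSeries.add_apply, h w hw]

/-- The moments determine the free cumulants. -/
theorem cumulant_unique {M R R' : NCSeries n ℝ} (hM : M [] = 0)
    (h : ncComp R (fun i => ncVar i * (1 + M)) = ncComp R' (fun i => ncVar i * (1 + M))) :
    R = R' := by
  have hV : ∀ i : Fin n, (ncVar i * (1 + M)) [] = 0 := fun i => ncVar_mul_nil i _
  have hu : IsUnit (1 + M) := isUnit_of_nil_eq_one _ (by
    rw [NCSeries.add_apply, hM, NCSeries.one_apply, if_pos rfl, add_zero])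
  refine NCSeries.ext fun w => ?_
  induction w generalizing R R' with
  | nil =>
    have := congrFun h []
    rw [ncComp_eq _ hV, ncComp_eq _ hV, NCSeries.add_apply, NCSeries.add_apply,
      NCSeries.sum_apply, NCSeries.sum_apply] at this
    simpa [mul_nil, ncVar_eq_var, var_apply, const_apply] using this
  | cons j w ih =>
    refine ih (R := leftDeriv j R) (R' := leftDeriv j R') ?_
    -- Removing the first letter `z_j` of the composition leaves the unit `1 + M` in front. It can
    -- be cancelled, so equality of compositions descends to the left derivatives.
    have h1 : ∀ F : NCSeries n ℝ, leftDeriv j (ncComp F fun i => ncVar i * (1 + M)) =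
        (1 + M) * ncComp (leftDeriv j F) fun i => ncVar i * (1 + M) := by
      intro F
      refine NCSeries.ext fun v => ?_
      rw [ncComp_eq F hV, leftDeriv_apply, NCSeries.add_apply, NCSeries.sum_apply,
        Finset.sum_eq_single j]
      · rw [mul_assoc, ncVar_eq_var, var_mul_cons, if_pos rfl, const_apply, if_neg (by simp),
          zero_add]
      · intro i _ hi
        rw [mul_assoc, ncVar_eq_var, var_mul_cons, if_neg hi.symm]
      · simp
    have h2 := h1 R
    rw [h, h1 R'] at h2
    exact (hu.mul_left_cancel h2).symm

theorem momentSeries_nil (φ : NCPoly n →ₗ[ℝ] ℝ) : momentSeries φ [] = 0 := rfl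

theorem momentSeries_cons (φ : NCPoly n →ₗ[ℝ] ℝ) (i : Fin n) (w : List (Fin n)) :
    momentSeries φ (i :: w) = φ (xMon (i :: w)) := by
  rw [momentSeries, mk_apply, if_neg (by simp)]

theorem IsFreeCumulantSeries.unique {φ : NCPoly n →ₗ[ℝ] ℝ} {R R' : NCSeries n ℝ}
    (h : IsFreeCumulantSeries φ R) (h' : IsFreeCumulantSeries φ R') : R = R' :=
  cumulant_unique (momentSeries_nil φ) (h.2.trans h'.2.symm)

theorem xMon_nil : xMon ([] : List (Fin n)) = 1 := rfl

theorem xMon_cons (i : Fin n) (u : List (Fin n)) : xMon (i :: u) = xVar i * xMon u := by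
  simp [xMon]

theorem basisFreeMonoid_apply (u : List (Fin n)) :
    FreeAlgebra.basisFreeMonoid ℝ (Fin n) (FreeMonoid.ofList u) = xMon u := by
  have h : FreeAlgebra.basisFreeMonoid ℝ (Fin n) (FreeMonoid.ofList u) =
      FreeAlgebra.equivMonoidAlgebraFreeMonoid.symm
        (MonoidAlgebra.single (FreeMonoid.ofList u) (1 : ℝ)) := by
    simp [FreeAlgebra.basisFreeMonoid]
  rw [h]
  change MonoidAlgebra.lift ℝ (FreeAlgebra ℝ (Fin n)) (FreeMonoid (Fin n))
    (FreeMonoid.lift (FreeAlgebra.ι ℝ)) (MonoidAlgebra.single (FreeMonoid.ofList u) (1 : ℝ)) = _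
  rw [MonoidAlgebra.lift_single, one_smul, FreeMonoid.lift_ofList]
  rfl

theorem functional_ext {φ φ' : NCPoly n →ₗ[ℝ] ℝ} (h : ∀ u, φ (xMon u) = φ' (xMon u)) : φ = φ' :=
  (FreeAlgebra.basisFreeMonoid ℝ (Fin n)).ext fun u => by
    have := h u.toList
    rwa [← basisFreeMonoid_apply] at this

/-- The functional with prescribed moments. -/
theorem exists_functional (m : List (Fin n) → ℝ) :
    ∃ φ : NCPoly n →ₗ[ℝ] ℝ, ∀ u, φ (xMon u) = m u :=
  ⟨(FreeAlgebra.basisFreeMonoid ℝ (Fin n)).constr ℝ fun u => m u.toList, fun u => by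
    rw [← basisFreeMonoid_apply, Module.Basis.constr_basis]; rfl⟩

/-- The moment series is obtained as the fixed point of `M ↦ R(z_1 (1 + M), …, z_n (1 + M))`, a
contraction because of the factors `z_i`. -/
theorem exists_functional_of_cumulants {R : NCSeries n ℝ} (hR : R [] = 0) :
    ∃ φ : NCPoly n →ₗ[ℝ] ℝ, φ 1 = 1 ∧ IsFreeCumulantSeries φ R := by
  obtain ⟨M, hM⟩ := exists_fixedPoint (fun M => ncComp R fun i => ncVar i * (1 + M))
    (moment_contraction R)
  obtain ⟨φ, hφ⟩ := exists_functional fun u => (1 + M) u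
  have hV : ∀ i : Fin n, (ncVar i * (1 + M)) [] = 0 := fun i => ncVar_mul_nil i _
  have hM0 : M [] = 0 := by
    rw [← hM, ncComp_eq _ hV, NCSeries.add_apply, NCSeries.sum_apply]
    simp [mul_nil, ncVar_eq_var, var_apply, const_apply, hR]
  have hm : momentSeries φ = M := NCSeries.ext_cons (by rw [hM0]; rfl) fun i w => by
    rw [momentSeries_cons, hφ, NCSeries.add_apply, NCSeries.one_apply, if_neg (by simp), zero_add]
  refine ⟨φ, ?_, hR, by rw [hm]; exact hM⟩
  rw [← xMon_nil, hφ, NCSeries.add_apply, hM0, NCSeries.one_apply, if_pos rfl, add_zero]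

theorem functional_unique {R : NCSeries n ℝ} {φ φ' : NCPoly n →ₗ[ℝ] ℝ} (h1 : φ 1 = 1)
    (h1' : φ' 1 = 1) (h : IsFreeCumulantSeries φ R) (h' : IsFreeCumulantSeries φ' R) :
    φ = φ' := by
  have hm := fixedPoint_unique (fun M => ncComp R fun i => ncVar i * (1 + M))
    (moment_contraction R) h.2 h'.2
  refine functional_ext fun u => ?_
  cases u with
  | nil => rw [xMon_nil, h1, h1']
  | cons i u => rw [← momentSeries_cons, hm, momentSeries_cons]

end Cumulants

/-! ### The polynomials defined by the recursion -/

section Recursion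

variable {n : ℕ}

/-- The coefficient of `P_u` in `x_i P_u`. -/
def midCoeff (b : Fin n → ℝ) (i : Fin n) : List (Fin n) → ℝ
  | [] => 0
  | j :: _ => if j = i then b i else 0

/-- The coefficient in `x_i P_u` of the polynomial at the tail of `u`. -/
def lowerCoeff (c : Fin n → ℝ) (i : Fin n) : List (Fin n) → ℝ
  | [] => 0
  | [j] => if j = i then 1 else 0
  | j :: k :: _ => if j = i then (if k = i then 1 + c i else 1) else 0

/-- The polynomials with
`x_i P_u = P_{(i,u)} + midCoeff b i u P_u + lowerCoeff c i u P_{u.tail}`. -/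
noncomputable def meixnerPoly (b c : Fin n → ℝ) : List (Fin n) → NCPoly n
  | [] => 1
  | [i] => xVar i
  | i :: j :: w => xVar i * meixnerPoly b c (j :: w) -
      midCoeff b i (j :: w) • meixnerPoly b c (j :: w) -
      lowerCoeff c i (j :: w) • meixnerPoly b c w

/-- The squared norm of `P_u`. -/
noncomputable def weight (c : Fin n → ℝ) : List (Fin n) → ℝ
  | [] => 1
  | i :: w => lowerCoeff c i (i :: w) * weight c w

variable (b c : Fin n → ℝ)

theorem lowerCoeff_of_ne {i j : Fin n} (h : j ≠ i) (w : List (Fin n)) :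
    lowerCoeff c i (j :: w) = 0 := by
  cases w <;> simp [lowerCoeff, h]

theorem lowerCoeff_self_self (i : Fin n) (w : List (Fin n)) :
    lowerCoeff c i (i :: i :: w) = 1 + c i := by simp [lowerCoeff]

theorem lowerCoeff_self_of_ne {i j : Fin n} (h : j ≠ i) (w : List (Fin n)) :
    lowerCoeff c i (i :: j :: w) = 1 := by simp [lowerCoeff, h]

theorem midCoeff_of_ne {i j : Fin n} (h : j ≠ i) (w : List (Fin n)) :
    midCoeff b i (j :: w) = 0 := by simp [midCoeff, h]

theorem midCoeff_self (i : Fin n) (w : List (Fin n)) :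
    midCoeff b i (i :: w) = b i := by simp [midCoeff]

theorem weight_nonneg (hc : ∀ i, -1 ≤ c i) (w : List (Fin n)) : 0 ≤ weight c w := by
  induction w with
  | nil => exact zero_le_one
  | cons i w ih =>
    refine mul_nonneg ?_ ih
    have := hc i
    cases w with
    | nil => simp [lowerCoeff]
    | cons j w =>
      rw [lowerCoeff, if_pos rfl]
      split_ifs <;> linarith

theorem weight_pos (hc : ∀ i, -1 < c i) (w : List (Fin n)) : 0 < weight c w := by
  induction w with
  | nil => exact zero_lt_one
  | cons i w ih =>
    refine mul_pos ?_ ih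
    have := hc i
    cases w with
    | nil => simp [lowerCoeff]
    | cons j w =>
      rw [lowerCoeff, if_pos rfl]
      split_ifs <;> linarith

theorem weight_pair (i : Fin n) : weight c [i, i] = 1 + c i := by simp [weight, lowerCoeff]

theorem xVar_mul_meixnerPoly (i : Fin n) (w : List (Fin n)) :
    xVar i * meixnerPoly b c w = meixnerPoly b c (i :: w) + midCoeff b i w • meixnerPoly b c w +
      lowerCoeff c i w • meixnerPoly b c w.tail := by
  cases w with
  | nil => simp [meixnerPoly, midCoeff, lowerCoeff]
  | cons j w => rw [meixnerPoly, List.tail_cons]; abel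

theorem meixnerPoly_cons (i : Fin n) (w : List (Fin n)) :
    meixnerPoly b c (i :: w) = xVar i * meixnerPoly b c w - midCoeff b i w • meixnerPoly b c w -
      lowerCoeff c i w • meixnerPoly b c w.tail := by
  rw [xVar_mul_meixnerPoly]; abel

theorem meixnerPoly_nil : meixnerPoly b c [] = 1 := by rw [meixnerPoly]

/-- The span contains `1` and, by the recursion, is stable under left multiplication by every `x_i`.
-/
theorem mem_span_meixnerPoly (S : NCPoly n) :
    S ∈ Submodule.span ℝ (Set.range (meixnerPoly b c)) := by
  have hx : ∀ u : List (Fin n), xMon u ∈ Submodule.span ℝ (Set.range (meixnerPoly b c)) := by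
    intro u
    induction u with
    | nil =>
      rw [xMon_nil, ← meixnerPoly_nil b c]
      exact Submodule.subset_span ⟨_, rfl⟩
    | cons i u ih =>
      rw [xMon_cons]
      generalize xMon u = p at ih
      induction ih using Submodule.span_induction with
      | mem x hx =>
        obtain ⟨w, rfl⟩ := hx
        rw [xVar_mul_meixnerPoly]
        exact Submodule.add_mem _ (Submodule.add_mem _ (Submodule.subset_span ⟨_, rfl⟩)
          (Submodule.smul_mem _ _ (Submodule.subset_span ⟨_, rfl⟩)))
          (Submodule.smul_mem _ _ (Submodule.subset_span ⟨_, rfl⟩))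
      | zero => rw [mul_zero]; exact Submodule.zero_mem _
      | add x y _ _ hx hy => rw [mul_add]; exact Submodule.add_mem _ hx hy
      | smul a x _ hx => rw [mul_smul_comm]; exact Submodule.smul_mem _ _ hx
  have := (FreeAlgebra.basisFreeMonoid ℝ (Fin n)).mem_span S
  refine Submodule.span_le.2 ?_ this
  rintro _ ⟨u, rfl⟩
  have h := basisFreeMonoid_apply u.toList
  rw [FreeMonoid.ofList_toList] at h
  rw [h]
  exact hx _

/-- The generating series of the moments `φ[x_u P_w]`, in terms of the moment series `G` and the
first-passage series `T`. -/
noncomputable def resolvent (G : NCSeries n ℝ) (T : Fin n → NCSeries n ℝ) :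
    List (Fin n) → NCSeries n ℝ
  | [] => G
  | i :: w => const (lowerCoeff c i (i :: w)) * (resolvent G T w * T i)

/-- The moments `φ[x_u P_w]` obey this recursion, seen by splitting off the last letter of `u`. Here
`∑ T_i z_i` plays the role of the first-return series: `hG` is the geometric series for `G`, and
`hT` is the quadratic equation of `T_j` with `G` cleared. -/
theorem resolvent_eq {G : NCSeries n ℝ} {T : Fin n → NCSeries n ℝ}
    (hG : G * (1 - ∑ i, T i * var i) = 1)
    (hT : ∀ j, T j * (1 - ∑ i, T i * var i) =
      (1 + const (b j) * T j + const (c j) * T j ^ 2) * var j) (w : List (Fin n)) :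
    resolvent c G T w = const (if w = [] then 1 else 0) +
      ∑ i, (resolvent c G T (i :: w) + const (midCoeff b i w) * resolvent c G T w +
        const (lowerCoeff c i w) * resolvent c G T w.tail) * var i := by
  cases w with
  | nil =>
    simp only [resolvent, midCoeff, lowerCoeff, if_pos, map_zero, zero_mul, add_zero, map_one,
      one_mul, mul_assoc]
    rw [← Finset.mul_sum]
    rw [mul_sub, mul_one, sub_eq_iff_eq_add] at hG
    exact hG
  | cons j w =>
    set K := ∑ i, T i * var i with hK
    set a := lowerCoeff c j (j :: w) with ha
    set Hw := resolvent c G T w with hHw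
    have hH : resolvent c G T (j :: w) = const a * (Hw * T j) := rfl
    -- Every letter contributes `H_{jw} T_i z_i`. For `i = j` the lowering coefficient `1 + c j`
    -- leaves a surplus `c j`, which with the diagonal and annihilation terms forms the quadratic of
    -- `hT`.
    have hterm : ∀ i, (resolvent c G T (i :: j :: w) +
        const (midCoeff b i (j :: w)) * resolvent c G T (j :: w) +
        const (lowerCoeff c i (j :: w)) * Hw) * var i =
        resolvent c G T (j :: w) * (T i * var i) + if i = j then
          const a * (Hw * ((1 + const (b j) * T j + const (c j) * T j ^ 2) * var j)) else 0 := by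
      intro i
      by_cases hij : i = j
      · subst hij
        rw [if_pos rfl, resolvent, lowerCoeff_self_self, midCoeff_self, ← ha, hH, map_add, map_one]
        have e1 : ∀ r : ℝ, Hw * (const r * T i) = const r * (Hw * T i) := fun r => by
          rw [← mul_assoc, ← const_mul_comm, mul_assoc]
        have e2 : ∀ (r : ℝ) (f : NCSeries n ℝ), const r * (const a * f) = const a * (const r * f) :=
          fun r f => by rw [← mul_assoc, const_mul_comm r, mul_assoc]
        have e3 : ∀ r : ℝ, Hw * (const r * T i ^ 2) = const r * (Hw * T i ^ 2) := fun r => by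
          rw [← mul_assoc, ← const_mul_comm, mul_assoc]
        rw [← mul_assoc Hw, mul_add, mul_add, mul_one, e1, e3]
        simp only [add_mul, mul_add, one_mul, mul_assoc, pow_two, e2]
        abel
      · have hji : j ≠ i := fun h => hij h.symm
        rw [if_neg hij, midCoeff_of_ne b hji, lowerCoeff_of_ne c hji, resolvent,
          lowerCoeff_self_of_ne c hji]
        simp only [map_zero, zero_mul, add_zero, map_one, one_mul, mul_assoc]
    rw [List.tail_cons, ← hHw, Finset.sum_congr rfl fun i _ => hterm i, Finset.sum_add_distrib,
      ← Finset.mul_sum, ← hK, Finset.sum_ite_eq' Finset.univ j, if_pos (Finset.mem_univ _), ← hT,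
      if_neg (by simp), map_zero, zero_add, ← mul_assoc Hw, ← mul_assoc (const a), ← hH, ← mul_add]
    simp

theorem star_smul_ncPoly (a : ℝ) (p : NCPoly n) : star (a • p) = a • star p := by
  rw [Algebra.smul_def, star_mul, FreeAlgebra.star_algebraMap, Algebra.smul_def,
    Algebra.commutes]

theorem star_xVar (i : Fin n) : star (xVar i) = xVar i := FreeAlgebra.star_ι i

end Recursion

/-! ### The free product functional -/

section Functional

variable {n : ℕ} {b c : Fin n → ℝ} {r : Fin n → PowerSeries ℝ} {φ : NCPoly n →ₗ[ℝ] ℝ}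

/-- In this fixed-point form the equation can be transported by any ring homomorphism, in particular
by composition. -/
theorem MeixnerEquation.divVar_eq {β γ : ℝ} {R : PowerSeries ℝ} (h : MeixnerEquation β γ R) :
    divVar R = (1 + PowerSeries.C β * divVar R + PowerSeries.C γ * divVar R ^ 2) *
      PowerSeries.X := by
  rw [← h.2.2, mul_comm]
  exact eq_X_mul_divVar _ (by rw [divVar, PowerSeries.coeff_mk]; exact h.2.1)

theorem MeixnerEquation.eq_mul_X {β γ : ℝ} {R : PowerSeries ℝ} (h : MeixnerEquation β γ R) :
    R = divVar R * PowerSeries.X := by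
  rw [mul_comm]
  exact eq_X_mul_divVar _ h.1

/-- The moments of `x_u P_w`. -/
theorem functional_xMon_mul (hr : ∀ i, MeixnerEquation (b i) (c i) (r i)) (h1 : φ 1 = 1)
    (hR : IsFreeCumulantSeries φ (∑ i, inVar i (r i))) :
    ∃ T : Fin n → NCSeries n ℝ, (∀ i, T i [] = 0) ∧ ∀ w u,
      φ (xMon u * meixnerPoly b c w) = resolvent c (1 + momentSeries φ) T w u := by
  set G := 1 + momentSeries φ with hGdef
  have hV : ∀ i, (ncVar i * G : NCSeries n ℝ) [] = 0 := fun i => ncVar_mul_nil i _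
  -- `κ i` is the ring homomorphism `f ↦ f(z_i G)`. Applied to the equations for `divVar (r i)` and
  -- `r i`, it gives `hT1` and the summands of `hM`.
  set κ := fun i => (compHom _ hV).comp (inVarHom i) with hκ
  have hX : ∀ i, κ i PowerSeries.X = var i * G := fun i => by
    rw [hκ]
    simp only [RingHom.comp_apply, inVarHom_apply, compHom_apply]
    rw [inVar_X, ncComp_var i hV]
    rfl
  have hC : ∀ i a, κ i (PowerSeries.C a) = const a := fun i a => by
    rw [hκ]
    simp only [RingHom.comp_apply, inVarHom_apply, compHom_apply]
    rw [inVar_C, ncComp_const a hV]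
  set T := fun i => κ i (divVar (r i)) with hTdef
  have hT1 : ∀ i, T i = (1 + const (b i) * T i + const (c i) * T i ^ 2) * (var i * G) := fun i => by
    rw [hTdef]
    simp only
    conv_lhs => rw [(hr i).divVar_eq]
    rw [map_mul, map_add, map_add, map_mul, map_mul, map_pow, hX, hC, hC, map_one]
  have hM : momentSeries φ = (∑ i, T i * var i) * G := by
    have h2 : compHom _ hV (∑ i, inVar i (r i)) = momentSeries φ := hR.2
    rw [← h2, map_sum, Finset.sum_mul]
    refine Finset.sum_congr rfl fun i _ => ?_
    change κ i (r i) = _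
    conv_lhs => rw [(hr i).eq_mul_X]
    rw [map_mul, hX, mul_assoc]
  have hu : IsUnit G := isUnit_of_nil_eq_one _ (by
    rw [hGdef, NCSeries.add_apply, momentSeries_nil, NCSeries.one_apply, if_pos rfl, add_zero])
  have hKG : (1 - ∑ i, T i * var i) * G = 1 := by
    rw [sub_mul, one_mul, ← hM, hGdef, add_sub_cancel_right]
  have hGK : G * (1 - ∑ i, T i * var i) = 1 := by
    refine hu.mul_right_cancel ?_
    rw [mul_assoc, hKG, mul_one, one_mul]
  have hTK : ∀ j, T j * (1 - ∑ i, T i * var i) =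
      (1 + const (b j) * T j + const (c j) * T j ^ 2) * var j := fun j => by
    conv_lhs => rw [hT1 j]
    rw [mul_assoc, mul_assoc, hGK, mul_one]
  refine ⟨T, fun i => ?_, ?_⟩
  · rw [hT1 i, mul_nil, var_mul_nil, mul_zero]
  have key : ∀ N : ℕ, ∀ w : List (Fin n), w.length < N → ∀ u,
      φ (xMon u * meixnerPoly b c w) = resolvent c G T w u := by
    intro N
    induction N with
    | zero => intro w hw; simp at hw
    | succ N ih =>
      intro w hw u
      cases w with
      | nil =>
        rw [meixnerPoly_nil, mul_one, resolvent, hGdef, NCSeries.add_apply]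
        cases u with
        | nil => rw [xMon_nil, h1, momentSeries_nil, NCSeries.one_apply, if_pos rfl, add_zero]
        | cons i u => rw [momentSeries_cons, NCSeries.one_apply, if_neg (by simp), zero_add]
      | cons i w =>
        have hw' : w.length < N := by simpa using hw
        -- At a word ending in `i` only the summand with right factor `z_i` survives.
        have h3 : (resolvent c G T w) (u ++ [i]) = resolvent c G T (i :: w) u +
            midCoeff b i w * resolvent c G T w u +
            lowerCoeff c i w * resolvent c G T w.tail u := by
          conv_lhs => rw [resolvent_eq b c hGK hTK w]
          rw [NCSeries.add_apply, NCSeries.sum_apply, const_apply, if_neg (by simp), zero_add]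
          simp only [mul_var_concat]
          rw [Finset.sum_ite_eq Finset.univ i, if_pos (Finset.mem_univ _), NCSeries.add_apply,
            NCSeries.add_apply, const_mul_apply, const_mul_apply]
        rw [meixnerPoly_cons, mul_sub, mul_sub, map_sub, map_sub, mul_smul_comm, mul_smul_comm,
          map_smul, map_smul, ih w hw' u, ih w.tail (by simp; omega) u, ← mul_assoc]
        have h4 : xMon u * xVar i = xMon (u ++ [i]) := by simp [xMon]
        rw [h4, ih w hw', h3, smul_eq_mul, smul_eq_mul]
        ring
  exact fun w u => key (w.length + 1) w (Nat.lt_succ_self _) u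

theorem functional_meixnerPoly (hr : ∀ i, MeixnerEquation (b i) (c i) (r i)) (h1 : φ 1 = 1)
    (hR : IsFreeCumulantSeries φ (∑ i, inVar i (r i))) (w : List (Fin n)) :
    φ (meixnerPoly b c w) = if w = [] then 1 else 0 := by
  cases w with
  | nil => rw [meixnerPoly_nil, h1, if_pos rfl]
  | cons i w =>
    obtain ⟨T, hT0, hT⟩ := functional_xMon_mul hr h1 hR
    have := hT (i :: w) []
    rw [xMon_nil, one_mul] at this
    rw [this, if_neg (by simp), resolvent, mul_nil, mul_nil, hT0, mul_zero, mul_zero]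

/-- Induction on `u`: the factor `x_i` of `P_{(i,u)}` is moved across to `P_v`, where the recursion
applies again. -/
theorem functional_star_mul (hr : ∀ i, MeixnerEquation (b i) (c i) (r i)) (h1 : φ 1 = 1)
    (hR : IsFreeCumulantSeries φ (∑ i, inVar i (r i))) (u v : List (Fin n)) :
    φ (star (meixnerPoly b c u) * meixnerPoly b c v) = if u = v then weight c u else 0 := by
  have key : ∀ N : ℕ, ∀ u : List (Fin n), u.length < N → ∀ v,
      φ (star (meixnerPoly b c u) * meixnerPoly b c v) = if u = v then weight c u else 0 := by
    intro N
    induction N with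
    | zero => intro u hu; simp at hu
    | succ N ih =>
      intro u hu v
      cases u with
      | nil =>
        rw [meixnerPoly_nil, star_one, one_mul, functional_meixnerPoly hr h1 hR, weight]
        simp only [eq_comm]
      | cons i u =>
        have hu' : u.length < N := by simpa using hu
        rw [meixnerPoly_cons, star_sub, star_sub, star_mul, star_xVar, star_smul_ncPoly,
          star_smul_ncPoly, sub_mul, sub_mul, mul_assoc, xVar_mul_meixnerPoly, mul_add, mul_add,
          smul_mul_assoc, smul_mul_assoc, mul_smul_comm, mul_smul_comm]
        simp only [map_sub, map_add, map_smul, smul_eq_mul]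
        rw [ih u hu', ih u hu', ih u hu', ih u.tail (by simp; omega)]
        -- The diagonal part is symmetric (`e1`), and the weights are chosen so that annihilation is
        -- adjoint to creation (`e2`, `e3`). After cancellation only the right-hand side of `e3`
        -- remains.
        have e1 : (midCoeff b i v * if u = v then weight c u else 0) =
            midCoeff b i u * if u = v then weight c u else 0 := by
          split_ifs with h
          · rw [h]
          · simp
        have e2 : (lowerCoeff c i u * if u.tail = v then weight c u.tail else 0) =
            if u = i :: v then weight c u else 0 := by
          cases u with
          | nil => simp [lowerCoeff]
          | cons j u =>
            by_cases hj : j = i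
            · subst hj
              by_cases h : u = v
              · rw [if_pos (show (j :: u).tail = v from h), if_pos (by rw [h]), List.tail_cons, weight]
              · rw [if_neg (show ¬ (j :: u).tail = v from h), if_neg (by simpa using h), mul_zero]
            · rw [lowerCoeff_of_ne c hj, zero_mul, if_neg (by simp [hj])]
        have e3 : (lowerCoeff c i v * if u = v.tail then weight c u else 0) =
            if i :: u = v then weight c (i :: u) else 0 := by
          cases v with
          | nil => simp [lowerCoeff]
          | cons j v =>
            by_cases hj : i = j
            · subst hj
              by_cases h : u = v
              · rw [if_pos (show u = (i :: v).tail from h), if_pos (by rw [h]), h, weight]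
              · rw [if_neg (show ¬ u = (i :: v).tail from h), if_neg (by simpa using h), mul_zero]
            · rw [lowerCoeff_of_ne c (Ne.symm hj), zero_mul, if_neg (by simp [hj])]
        rw [e1, e2, e3]
        ring
  exact key (u.length + 1) u (Nat.lt_succ_self _) v

/-- A spanning family suffices here: linear independence of the `P_u` is not needed, and could not
be deduced from orthogonality when some weights vanish. -/
theorem exists_functional_star_mul_self (hr : ∀ i, MeixnerEquation (b i) (c i) (r i))
    (h1 : φ 1 = 1) (hR : IsFreeCumulantSeries φ (∑ i, inVar i (r i))) (S : NCPoly n) :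
    ∃ a : List (Fin n) →₀ ℝ, (S = ∑ u ∈ a.support, a u • meixnerPoly b c u) ∧
      φ (star S * S) = ∑ u ∈ a.support, a u ^ 2 * weight c u := by
  obtain ⟨a, ha⟩ := Finsupp.mem_span_range_iff_exists_finsupp.1 (mem_span_meixnerPoly b c S)
  rw [Finsupp.sum] at ha
  refine ⟨a, ha.symm, ?_⟩
  rw [← ha, star_sum, Finset.sum_mul, map_sum]
  refine Finset.sum_congr rfl fun u hu => ?_
  rw [Finset.mul_sum, map_sum, Finset.sum_eq_single u]
  · rw [star_smul_ncPoly, smul_mul_assoc, mul_smul_comm, map_smul, map_smul,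
      functional_star_mul hr h1 hR, if_pos rfl, smul_eq_mul, smul_eq_mul]
    ring
  · intro v _ hv
    rw [star_smul_ncPoly, smul_mul_assoc, mul_smul_comm, map_smul, map_smul,
      functional_star_mul hr h1 hR, if_neg (Ne.symm hv), smul_zero, smul_zero]
  · exact fun h => absurd hu h

theorem functional_isState (hr : ∀ i, MeixnerEquation (b i) (c i) (r i)) (h1 : φ 1 = 1)
    (hR : IsFreeCumulantSeries φ (∑ i, inVar i (r i))) (hc : ∀ i, -1 ≤ c i) : IsState φ := by
  refine ⟨h1, fun S => ?_⟩
  obtain ⟨a, -, ha⟩ := exists_functional_star_mul_self hr h1 hR S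
  rw [ha]
  exact Finset.sum_nonneg fun u _ => mul_nonneg (sq_nonneg _) (weight_nonneg c hc u)

theorem meixnerPoly_pair_ne_zero (i : Fin n) : meixnerPoly b c [i, i] ≠ 0 := by
  intro h
  -- The value at `x = 0` of `P_{(i,i)} = x_i² - b_i x_i - 1` is `-1`.
  have := congrArg (FreeAlgebra.lift ℝ fun _ : Fin n => (0 : ℝ)) h
  rw [meixnerPoly_cons] at this
  simp [meixnerPoly, lowerCoeff, midCoeff, xVar] at this

theorem functional_isFaithful_iff (hr : ∀ i, MeixnerEquation (b i) (c i) (r i)) (h1 : φ 1 = 1)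
    (hR : IsFreeCumulantSeries φ (∑ i, inVar i (r i))) (hc : ∀ i, -1 ≤ c i) :
    IsFaithful φ ↔ ∀ i, -1 < c i := by
  constructor
  · intro h i
    refine lt_of_le_of_ne (hc i) fun hi => meixnerPoly_pair_ne_zero (b := b) (c := c) i (h _ ?_)
    rw [functional_star_mul hr h1 hR, if_pos rfl, weight_pair, ← hi]
    norm_num
  · intro h S hS
    obtain ⟨a, ha, ha'⟩ := exists_functional_star_mul_self hr h1 hR S
    rw [hS] at ha'
    rw [ha]
    have h0 := (Finset.sum_eq_zero_iff_of_nonneg fun u _ =>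
      mul_nonneg (sq_nonneg (a u)) (weight_pos c h u).le).1 ha'.symm
    refine Finset.sum_eq_zero fun u hu => ?_
    have := h0 u hu
    rcases mul_eq_zero.1 this with h2 | h2
    · rw [pow_eq_zero_iff two_ne_zero] at h2
      rw [h2, zero_smul]
    · exact absurd h2 (weight_pos c h u).ne'

end Functional

/-! ### The one-variable equation -/

section OneVariable

variable {β γ : ℝ}

/-- The polynomial `1 + β z + γ z²`. -/
noncomputable def meixnerDen (β γ : ℝ) : PowerSeries ℝ :=
  1 + PowerSeries.C β * PowerSeries.X + PowerSeries.C γ * PowerSeries.X ^ 2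

theorem constantCoeff_meixnerDen : PowerSeries.constantCoeff (meixnerDen β γ) = 1 := by
  simp [meixnerDen]

/-- The equation `Y = (1 + β Y + γ Y²) V` has at most one solution if `V` has no constant term. -/
theorem quadratic_unique {V Y Y' : PowerSeries ℝ} (hV : PowerSeries.coeff 0 V = 0)
    (h : Y = (1 + PowerSeries.C β * Y + PowerSeries.C γ * Y ^ 2) * V)
    (h' : Y' = (1 + PowerSeries.C β * Y' + PowerSeries.C γ * Y' ^ 2) * V) : Y = Y' := by
  -- The difference of the two equations factors, and the second factor has constant term `1`.
  have h1 : (Y - Y') * (1 - V * (PowerSeries.C β + PowerSeries.C γ * (Y + Y'))) = 0 := by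
    linear_combination h - h'
  rcases mul_eq_zero.1 h1 with h2 | h2
  · exact sub_eq_zero.1 h2
  · have := congrArg PowerSeries.constantCoeff h2
    rw [PowerSeries.coeff_zero_eq_constantCoeff_apply] at hV
    simp [hV] at this

theorem MeixnerEquation.unique {R R' : PowerSeries ℝ} (h : MeixnerEquation β γ R)
    (h' : MeixnerEquation β γ R') : R = R' := by
  rw [h.eq_mul_X, h'.eq_mul_X, quadratic_unique (by simp) h.divVar_eq h'.divVar_eq]

theorem hasSubst_of_coeff_zero {V : PowerSeries ℝ} (hV : PowerSeries.coeff 0 V = 0) :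
    PowerSeries.HasSubst V :=
  PowerSeries.HasSubst.of_constantCoeff_zero'
    (by rw [← PowerSeries.coeff_zero_eq_constantCoeff_apply, hV])

theorem subst_quadratic {V : PowerSeries ℝ} (hV : PowerSeries.coeff 0 V = 0)
    (S W : PowerSeries ℝ) :
    PowerSeries.subst V ((1 + PowerSeries.C β * S + PowerSeries.C γ * S ^ 2) * W) =
      (1 + PowerSeries.C β * PowerSeries.subst V S +
        PowerSeries.C γ * PowerSeries.subst V S ^ 2) * PowerSeries.subst V W := by
  have hs := hasSubst_of_coeff_zero hV
  have hC : ∀ a : ℝ, PowerSeries.substAlgHom (R := ℝ) hs (PowerSeries.C a) = PowerSeries.C a :=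
    fun a => by rw [PowerSeries.coe_substAlgHom, PowerSeries.subst_C]; rfl
  simp only [← PowerSeries.coe_substAlgHom hs, map_mul, map_add, map_pow, map_one, hC]

/-- Substituting `V` in the equation for `R(z)/z` gives one direction. Conversely, `z` and the
substituted series both solve `Y = (1 + β Y + γ Y²) V`, which has a unique solution. -/
theorem isDivInverse₁_iff {R V : PowerSeries ℝ} (h : MeixnerEquation β γ R) :
    IsDivInverse₁ R V ↔ meixnerDen β γ * V = PowerSeries.X := by
  constructor
  · rintro ⟨hV, hS⟩
    have e : PowerSeries.subst V (divVar R) = (1 + PowerSeries.C β * PowerSeries.subst V (divVar R) +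
        PowerSeries.C γ * PowerSeries.subst V (divVar R) ^ 2) *
          PowerSeries.subst V (PowerSeries.X : PowerSeries ℝ) := by
      conv_lhs => rw [h.divVar_eq, subst_quadratic hV]
    rw [hS, PowerSeries.subst_X (hasSubst_of_coeff_zero hV)] at e
    exact e.symm
  · intro hV
    have hV0 : PowerSeries.coeff 0 V = 0 := by
      have := congrArg PowerSeries.constantCoeff hV
      rw [PowerSeries.coeff_zero_eq_constantCoeff_apply]
      rwa [map_mul, constantCoeff_meixnerDen, one_mul, PowerSeries.constantCoeff_X] at this
    refine ⟨hV0, quadratic_unique hV0 ?_ hV.symm⟩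
    conv_lhs => rw [h.divVar_eq, subst_quadratic hV0,
      PowerSeries.subst_X (hasSubst_of_coeff_zero hV0)]

theorem exists_meixnerDen_mul_eq (β γ : ℝ) : ∃ V, meixnerDen β γ * V = PowerSeries.X :=
  ⟨(meixnerDen β γ)⁻¹ * PowerSeries.X, by
    rw [← mul_assoc, PowerSeries.mul_inv_cancel _ (by simp [constantCoeff_meixnerDen]), one_mul]⟩

/-- The solution is `z S`, with `S` the compositional inverse of `z/(1 + β z + γ z²)`, which exists
because the linear coefficient is `1`. -/
theorem exists_meixnerEquation (β γ : ℝ) : ∃ R, MeixnerEquation β γ R := by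
  obtain ⟨V, hV⟩ := exists_meixnerDen_mul_eq β γ
  have hV0 : PowerSeries.constantCoeff V = 0 := by
    have := congrArg PowerSeries.constantCoeff hV
    rwa [map_mul, constantCoeff_meixnerDen, one_mul, PowerSeries.constantCoeff_X] at this
  have hV1 : PowerSeries.coeff 1 V = 1 := by
    have h := congrArg (PowerSeries.coeff 1) hV
    rw [PowerSeries.coeff_mul, Finset.Nat.sum_antidiagonal_eq_sum_range_succ_mk] at h
    simpa [Finset.sum_range_succ, hV0, constantCoeff_meixnerDen] using h
  have hu : IsUnit (PowerSeries.coeff 1 V) := by rw [hV1]; exact isUnit_one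
  have hr := V.subst_substInvOfIsUnit_right hV0 hu
  set S := V.substInvOfIsUnit hu with hS
  have hS0 : PowerSeries.coeff 0 S = 0 := by
    rw [PowerSeries.coeff_zero_eq_constantCoeff_apply, hS,
      PowerSeries.constantCoeff_substInvOfIsUnit]
  have hs := hasSubst_of_coeff_zero hS0
  have h1 : (1 + PowerSeries.C β * S + PowerSeries.C γ * S ^ 2) * PowerSeries.X = S := by
    have h2 := congrArg (PowerSeries.subst S) hV
    rw [meixnerDen, subst_quadratic hS0, PowerSeries.subst_X hs] at h2
    change _ * PowerSeries.subst S V = _ at h2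
    rwa [hr] at h2
  have hd : divVar (PowerSeries.X * S) = S := divVar_X_mul S
  refine ⟨PowerSeries.X * S, by simp, ?_, ?_⟩
  · have : PowerSeries.coeff 1 (PowerSeries.X * S) = PowerSeries.coeff 0 S :=
      PowerSeries.coeff_succ_X_mul 0 S
    rw [this, hS0]
  · rw [hd]
    conv_lhs => rw [← h1, mul_comm, divVar_X_mul]

theorem MeixnerEquation.subst_eq {R V : PowerSeries ℝ} (h : MeixnerEquation β γ R)
    (hV : IsDivInverse₁ R V) : PowerSeries.subst V R = (PowerSeries.X * V : PowerSeries ℝ) := by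
  have hs := hasSubst_of_coeff_zero hV.1
  rw [h.eq_mul_X, PowerSeries.subst_mul hs, hV.2, PowerSeries.subst_X hs]

/-- The one-variable free Meixner polynomials, by their recursion. -/
noncomputable def oneVarPoly (β γ : ℝ) : ℕ → Polynomial ℝ
  | 0 => 1
  | 1 => Polynomial.X
  | 2 => (Polynomial.X - Polynomial.C β) * Polynomial.X - 1
  | k + 3 => (Polynomial.X - Polynomial.C β) * oneVarPoly β γ (k + 2) -
      Polynomial.C (1 + γ) * oneVarPoly β γ (k + 1)

/-- This is the generating function identity multiplied by `1 + β z + γ z²`, since `1 - x V + z V`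
then becomes `1 + β z + γ z² - x z + z²`. -/
theorem oneVarPoly_genFun (β γ : ℝ) :
    PowerSeries.mk (oneVarPoly β γ) *
      (PowerSeries.map Polynomial.C (meixnerDen β γ) -
        PowerSeries.C (Polynomial.X : Polynomial ℝ) * PowerSeries.X + PowerSeries.X ^ 2) =
      PowerSeries.map Polynomial.C (meixnerDen β γ) := by
  have e : PowerSeries.mk (oneVarPoly β γ) *
      (PowerSeries.map Polynomial.C (meixnerDen β γ) -
        PowerSeries.C (Polynomial.X : Polynomial ℝ) * PowerSeries.X + PowerSeries.X ^ 2) =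
      PowerSeries.mk (oneVarPoly β γ) +
        PowerSeries.C (Polynomial.C β - Polynomial.X) * PowerSeries.mk (oneVarPoly β γ) *
          PowerSeries.X +
        PowerSeries.C (Polynomial.C (1 + γ)) * PowerSeries.mk (oneVarPoly β γ) *
          PowerSeries.X * PowerSeries.X := by
    simp only [meixnerDen, map_add, map_mul, map_one, map_pow, PowerSeries.map_C,
      PowerSeries.map_X, map_sub]
    ring
  have e' : PowerSeries.map Polynomial.C (meixnerDen β γ) =
      PowerSeries.C 1 + PowerSeries.C (Polynomial.C β) * PowerSeries.X +
        PowerSeries.C (Polynomial.C γ) * PowerSeries.X * PowerSeries.X := by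
    simp only [meixnerDen, map_add, map_mul, map_one, map_pow, PowerSeries.map_C,
      PowerSeries.map_X]
    ring
  have hd : Polynomial.C (1 + γ) = 1 + Polynomial.C γ := by rw [map_add, map_one]
  rw [e, e']
  generalize ha : Polynomial.C β - Polynomial.X = a
  generalize hδ : Polynomial.C (1 + γ) = δ at hd
  refine PowerSeries.ext fun k => ?_
  match k with
  | 0 => simp [oneVarPoly]
  | 1 => simp [PowerSeries.coeff_succ_mul_X, oneVarPoly, PowerSeries.coeff_C, ← ha]
  | 2 =>
    simp [PowerSeries.coeff_succ_mul_X, oneVarPoly, PowerSeries.coeff_C]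
    rw [← ha, hd]
    ring
  | k + 3 =>
    simp only [PowerSeries.coeff_succ_mul_X, oneVarPoly, PowerSeries.coeff_C, map_add,
      PowerSeries.coeff_C_mul, PowerSeries.coeff_mk]
    rw [← ha]
    simp [hd]
    ring

theorem isFreeMeixnerPolynomials_iff {p : ℕ → Polynomial ℝ} :
    IsFreeMeixnerPolynomials β γ p ↔ p = oneVarPoly β γ := by
  have key : ∀ R U, MeixnerEquation β γ R → IsDivInverse₁ R U →
      PowerSeries.mk (oneVarPoly β γ) *
      (1 - PowerSeries.C (Polynomial.X : Polynomial ℝ) * PowerSeries.map Polynomial.C U +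
        PowerSeries.map Polynomial.C (PowerSeries.subst U R : PowerSeries ℝ)) = 1 := by
    intro R U hR hU
    have hU' := congrArg (PowerSeries.map Polynomial.C) ((isDivInverse₁_iff hR).1 hU)
    rw [map_mul, PowerSeries.map_X] at hU'
    rw [hR.subst_eq hU, map_mul, PowerSeries.map_X]
    have h0 : PowerSeries.map Polynomial.C (meixnerDen β γ) ≠ 0 := by
      intro h0
      have := congrArg PowerSeries.constantCoeff h0
      simp [meixnerDen] at this
    refine mul_right_cancel₀ h0 ?_
    rw [one_mul]
    conv_rhs => rw [← oneVarPoly_genFun]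
    linear_combination PowerSeries.mk (oneVarPoly β γ) *
      (PowerSeries.X - PowerSeries.C (Polynomial.X : Polynomial ℝ)) * hU'
  constructor
  · rintro ⟨R, U, hR, hU, h⟩
    have h1 := left_inv_eq_right_inv h ((mul_comm _ _).trans (key R U hR hU))
    funext k
    have := congrArg (PowerSeries.coeff k) h1
    rwa [PowerSeries.coeff_mk, PowerSeries.coeff_mk] at this
  · rintro rfl
    obtain ⟨R, hR⟩ := exists_meixnerEquation β γ
    obtain ⟨V, hV⟩ := exists_meixnerDen_mul_eq β γ
    have hU := (isDivInverse₁_iff hR).2 hV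
    exact ⟨R, V, hR, hU, key R V hR hU⟩

end OneVariable

/-! ### One variable as the case `n = 1` -/

section Transfer

/-- The functional on `ℝ⟨x_1⟩` given by a functional on `ℝ[x]`. -/
noncomputable def toNC (ψ : Polynomial ℝ →ₗ[ℝ] ℝ) : NCPoly 1 →ₗ[ℝ] ℝ :=
  ψ ∘ₗ (FreeAlgebra.lift ℝ fun _ : Fin 1 => (Polynomial.X : Polynomial ℝ)).toLinearMap

/-- The functional on `ℝ[x]` given by a functional on `ℝ⟨x_1⟩`. -/
noncomputable def ofNC (φ : NCPoly 1 →ₗ[ℝ] ℝ) : Polynomial ℝ →ₗ[ℝ] ℝ :=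
  φ ∘ₗ (Polynomial.aeval (xVar (0 : Fin 1)) : Polynomial ℝ →ₐ[ℝ] NCPoly 1).toLinearMap

theorem lift_comp_aeval :
    (FreeAlgebra.lift ℝ fun _ : Fin 1 => (Polynomial.X : Polynomial ℝ)).comp
      (Polynomial.aeval (xVar (0 : Fin 1))) = AlgHom.id ℝ (Polynomial ℝ) := by
  refine Polynomial.algHom_ext ?_
  simp [xVar]

theorem aeval_comp_lift :
    (Polynomial.aeval (xVar (0 : Fin 1))).comp
      (FreeAlgebra.lift ℝ fun _ : Fin 1 => (Polynomial.X : Polynomial ℝ)) =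
      AlgHom.id ℝ (NCPoly 1) := by
  refine FreeAlgebra.hom_ext (funext fun i => ?_)
  fin_cases i
  simp [xVar]

theorem ofNC_toNC (ψ : Polynomial ℝ →ₗ[ℝ] ℝ) : ofNC (toNC ψ) = ψ :=
  LinearMap.ext fun S => congrArg ψ (DFunLike.congr_fun lift_comp_aeval S)

theorem toNC_ofNC (φ : NCPoly 1 →ₗ[ℝ] ℝ) : toNC (ofNC φ) = φ :=
  LinearMap.ext fun S => congrArg φ (DFunLike.congr_fun aeval_comp_lift S)

theorem toNC_one (ψ : Polynomial ℝ →ₗ[ℝ] ℝ) : toNC ψ 1 = ψ 1 := by simp [toNC]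

theorem momentSeries_toNC (ψ : Polynomial ℝ →ₗ[ℝ] ℝ) :
    momentSeries (toNC ψ) = inVar 0 (momentSeries₁ ψ) := by
  refine NCSeries.ext fun w => ?_
  have hw : w = List.replicate w.length 0 := List.eq_replicate_of_mem fun i _ => Subsingleton.elim _ _
  rw [hw, inVar_replicate, momentSeries₁, PowerSeries.coeff_mk, momentSeries, mk_apply]
  simp [xMon, toNC, xVar]

theorem isFreeCumulantSeries_toNC {ψ : Polynomial ℝ →ₗ[ℝ] ℝ} {R : PowerSeries ℝ} :
    IsFreeCumulantSeries (toNC ψ) (inVar 0 R) ↔ IsFreeCumulantSeries₁ ψ R := by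
  rw [IsFreeCumulantSeries, IsFreeCumulantSeries₁, inVar_nil, momentSeries_toNC]
  refine and_congr_right fun _ => ?_
  rw [ncComp_inVar (n := 1) 0 R (PowerSeries.X * (1 + momentSeries₁ ψ)) (by simp)
    (fun j => ncVar_mul_nil j _) (by rw [inVar_X_mul, inVar_add, inVar_one]; rfl)]
  exact (inVar_injective 0).eq_iff

theorem IsFreeCumulantSeries₁.unique {ψ : Polynomial ℝ →ₗ[ℝ] ℝ} {R R' : PowerSeries ℝ}
    (h : IsFreeCumulantSeries₁ ψ R) (h' : IsFreeCumulantSeries₁ ψ R') : R = R' :=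
  inVar_injective (0 : Fin 1)
    ((isFreeCumulantSeries_toNC.2 h).unique (isFreeCumulantSeries_toNC.2 h'))

theorem functional₁_unique {ψ ψ' : Polynomial ℝ →ₗ[ℝ] ℝ} {R : PowerSeries ℝ} (h1 : ψ 1 = 1)
    (h1' : ψ' 1 = 1) (h : IsFreeCumulantSeries₁ ψ R) (h' : IsFreeCumulantSeries₁ ψ' R) :
    ψ = ψ' := by
  rw [← ofNC_toNC ψ, ← ofNC_toNC ψ', functional_unique (by rw [toNC_one, h1])
    (by rw [toNC_one, h1']) (isFreeCumulantSeries_toNC.2 h) (isFreeCumulantSeries_toNC.2 h')]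

theorem star_aeval_xVar {n : ℕ} (i : Fin n) (S : Polynomial ℝ) :
    star (Polynomial.aeval (xVar i) S) = Polynomial.aeval (xVar i) S := by
  induction S using Polynomial.induction_on' with
  | add p q hp hq => rw [map_add, star_add, hp, hq]
  | monomial k a =>
    rw [Polynomial.aeval_monomial, star_mul, star_pow, star_xVar, FreeAlgebra.star_algebraMap,
      Algebra.commutes]

/-- In one variable the involution is trivial, so positivity on `S* S` and on squares is the same
condition. -/
theorem star_lift_mul_lift (S : NCPoly 1) :
    FreeAlgebra.lift ℝ (fun _ : Fin 1 => (Polynomial.X : Polynomial ℝ)) (star S * S) =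
      FreeAlgebra.lift ℝ (fun _ : Fin 1 => (Polynomial.X : Polynomial ℝ)) S *
        FreeAlgebra.lift ℝ (fun _ : Fin 1 => (Polynomial.X : Polynomial ℝ)) S := by
  set π := FreeAlgebra.lift ℝ (fun _ : Fin 1 => (Polynomial.X : Polynomial ℝ)) with hπ
  have h : Polynomial.aeval (xVar (0 : Fin 1)) (π S) = S := DFunLike.congr_fun aeval_comp_lift S
  rw [map_mul]
  congr 1
  rw [← h, star_aeval_xVar]

theorem toNC_isState {ψ : Polynomial ℝ →ₗ[ℝ] ℝ} (h : IsState₁ ψ) : IsState (toNC ψ) :=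
  ⟨by rw [toNC_one, h.1], fun S => by
    have : toNC ψ (star S * S) = ψ _ := congrArg ψ (star_lift_mul_lift S)
    rw [this]
    exact h.2 _⟩

theorem ofNC_isState {φ : NCPoly 1 →ₗ[ℝ] ℝ} (h : IsState φ) : IsState₁ (ofNC φ) :=
  ⟨by simp [ofNC, h.1], fun S => by
    have e : ofNC φ (S * S) = φ (star (Polynomial.aeval (xVar 0) S) *
        Polynomial.aeval (xVar 0) S) := by
      rw [star_aeval_xVar]
      simp [ofNC]
    rw [e]
    exact h.2 _⟩

theorem sum_inVar_one (R : PowerSeries ℝ) : ∑ i : Fin 1, inVar i R = inVar (0 : Fin 1) R := by simp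

variable {β γ : ℝ}

theorem IsFreeMeixnerState₁.unique {ψ ψ' : Polynomial ℝ →ₗ[ℝ] ℝ}
    (h : IsFreeMeixnerState₁ β γ ψ) (h' : IsFreeMeixnerState₁ β γ ψ') : ψ = ψ' := by
  obtain ⟨hs, R, hR, hm⟩ := h
  obtain ⟨hs', R', hR', hm'⟩ := h'
  rw [hm'.unique hm] at hR'
  exact functional₁_unique hs.1 hs'.1 hR hR'

/-- The squared norm of the second polynomial is `1 + γ`; the orthogonality computation does not
presuppose positivity. -/
theorem IsFreeMeixnerState₁.neg_one_le {ψ : Polynomial ℝ →ₗ[ℝ] ℝ}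
    (h : IsFreeMeixnerState₁ β γ ψ) : -1 ≤ γ := by
  obtain ⟨hs, R, hR, hm⟩ := h
  have hφ := toNC_isState hs
  have := functional_star_mul (n := 1) (b := fun _ => β) (c := fun _ => γ) (r := fun _ => R)
    (φ := toNC ψ) (fun _ => hm) hφ.1 (by rw [sum_inVar_one]; exact isFreeCumulantSeries_toNC.2 hR)
    [0, 0] [0, 0]
  rw [if_pos rfl, weight_pair] at this
  have h2 := hφ.2 (meixnerPoly (fun _ => β) (fun _ => γ) [0, 0])
  rw [this] at h2
  linarith

theorem exists_isFreeMeixnerState₁ (hγ : -1 ≤ γ) :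
    ∃ ψ : Polynomial ℝ →ₗ[ℝ] ℝ, IsFreeMeixnerState₁ β γ ψ := by
  obtain ⟨R, hm⟩ := exists_meixnerEquation β γ
  obtain ⟨φ, h1, hφ⟩ := exists_functional_of_cumulants (n := 1) (R := inVar 0 R)
    (by rw [inVar_nil, hm.1])
  refine ⟨ofNC φ, ofNC_isState ?_, R, ?_, hm⟩
  · exact functional_isState (b := fun _ => β) (c := fun _ => γ) (r := fun _ => R)
      (fun _ => hm) h1 (by rw [sum_inVar_one]; exact hφ) (fun _ => hγ)
  · rw [← isFreeCumulantSeries_toNC, toNC_ofNC]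
    exact hφ

end Transfer

/-! ### The free Sheffer polynomials of the free product -/

section Sheffer

variable {n : ℕ} {b c : Fin n → ℝ} {r V : Fin n → PowerSeries ℝ}

theorem leftDeriv_sum_inVar (i : Fin n) (r : Fin n → PowerSeries ℝ) :
    leftDeriv i (∑ j, inVar j (r j)) = inVar i (divVar (r i)) := by
  have h : leftDeriv i (∑ j, inVar j (r j)) = ∑ j, leftDeriv i (inVar j (r j)) :=
    NCSeries.ext fun w => by
      rw [leftDeriv_apply, NCSeries.sum_apply, NCSeries.sum_apply]
      rfl
  rw [h, Finset.sum_eq_single i (fun j _ hj => leftDeriv_inVar_of_ne hj.symm _) (by simp),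
    leftDeriv_inVar_self]

theorem isGradInverse_inVar (hr : ∀ i, MeixnerEquation (b i) (c i) (r i))
    (hV : ∀ i, meixnerDen (b i) (c i) * V i = PowerSeries.X) :
    IsGradInverse (∑ i, inVar i (r i)) fun i => inVar i (V i) := by
  have hV' := fun i => (isDivInverse₁_iff (hr i)).2 (hV i)
  have h0 : ∀ i, inVar i (V i) [] = 0 := fun i => by rw [inVar_nil, (hV' i).1]
  refine fun i => ⟨h0 i, ?_⟩
  rw [leftDeriv_sum_inVar, ncComp_inVar i _ (V i) (hV' i).1 h0 rfl, (hV' i).2, inVar_X]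
  rfl

/-- Applying `f ↦ f(U_i)` to the quadratic equation gives `(1 + b_i z_i + c_i z_i²) U_i = z_i`,
whose left factor is a unit. -/
theorem IsGradInverse.eq_inVar (hr : ∀ i, MeixnerEquation (b i) (c i) (r i))
    (hV : ∀ i, meixnerDen (b i) (c i) * V i = PowerSeries.X) {U : Fin n → NCSeries n ℝ}
    (h : IsGradInverse (∑ i, inVar i (r i)) U) : U = fun i => inVar i (V i) := by
  funext i
  have h0 := fun i => (h i).1
  have hi := (h i).2
  rw [leftDeriv_sum_inVar] at hi
  set κ := (compHom U h0).comp (inVarHom i) with hκ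
  have hX : κ PowerSeries.X = U i := by
    rw [hκ, RingHom.comp_apply, inVarHom_apply, compHom_apply, inVar_X, ncComp_var i h0]
  have hC : ∀ a, κ (PowerSeries.C a) = const a := fun a => by
    rw [hκ, RingHom.comp_apply, inVarHom_apply, compHom_apply, inVar_C, ncComp_const a h0]
  have hS : κ (divVar (r i)) = var i := hi
  have h1 : inVar i (meixnerDen (b i) (c i)) * U i = var i := by
    conv_rhs => rw [← hS, (hr i).divVar_eq]
    rw [map_mul, map_add, map_add, map_mul, map_mul, map_pow, hX, hC, hC, map_one, hS, meixnerDen,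
      ← inVar_X, ← inVarHom_apply, ← inVarHom_apply, map_add, map_add, map_mul, map_mul, map_pow,
      map_one, inVarHom_apply i (PowerSeries.C _), inVarHom_apply i (PowerSeries.C _), inVar_C,
      inVar_C]
  have hu : IsUnit (inVar i (meixnerDen (b i) (c i))) := isUnit_of_nil_eq_one _ (by
    rw [inVar_nil, PowerSeries.coeff_zero_eq_constantCoeff_apply, constantCoeff_meixnerDen])
  refine hu.mul_left_cancel ?_
  rw [h1, ← inVar_mul, hV, inVar_X]

theorem ncComp_sum_inVar (hr : ∀ i, MeixnerEquation (b i) (c i) (r i))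
    (hV : ∀ i, meixnerDen (b i) (c i) * V i = PowerSeries.X) :
    ncComp (∑ i, inVar i (r i)) (fun i => inVar i (V i)) = ∑ i, var i * inVar i (V i) := by
  have hV' := fun i => (isDivInverse₁_iff (hr i)).2 (hV i)
  have h0 : ∀ i, inVar i (V i) [] = 0 := fun i => by rw [inVar_nil, (hV' i).1]
  rw [← compHom_apply _ h0, map_sum]
  refine Finset.sum_congr rfl fun i _ => ?_
  rw [compHom_apply, ncComp_inVar i _ (V i) (hV' i).1 h0 rfl, (hr i).subst_eq (hV' i),
    inVar_X_mul]

/-- The recursion for the polynomials, as an equation between series. -/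
theorem meixnerDen_mul_meixnerPoly (i : Fin n) :
    NCSeries.map (algebraMap ℝ (NCPoly n)) (inVar i (meixnerDen (b i) (c i))) *
        mk (fun w => meixnerPoly b c (i :: w)) =
      (const (xVar i) - var i) * mk (meixnerPoly b c) := by
  have hE : NCSeries.map (algebraMap ℝ (NCPoly n)) (inVar i (meixnerDen (b i) (c i))) =
      1 + const (algebraMap ℝ (NCPoly n) (b i)) * var i +
        const (algebraMap ℝ (NCPoly n) (c i)) * (var i * var i) := by
    rw [meixnerDen, inVar_add, inVar_add, inVar_C_mul, inVar_C_mul, pow_two, inVar_X_mul,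
      inVar_X, inVar_one]
    simp only [map_add, map_mul, map_one, map_var, NCSeries.map_const]
  rw [hE]
  refine NCSeries.ext fun w => ?_
  rw [add_mul, add_mul, one_mul, sub_mul, mul_assoc, mul_assoc, mul_assoc, NCSeries.add_apply,
    NCSeries.add_apply, NCSeries.sub_apply, const_mul_apply, const_mul_apply, const_mul_apply,
    mk_apply, mk_apply, xVar_mul_meixnerPoly]
  cases w with
  | nil => simp [var_mul_nil, midCoeff, lowerCoeff]
  | cons j w =>
    rw [var_mul_cons, var_mul_cons, var_mul_cons]
    by_cases hj : j = i
    · subst hj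
      rw [if_pos rfl, if_pos rfl, if_pos rfl, midCoeff_self, mk_apply, mk_apply, List.tail_cons,
        ← Algebra.smul_def, ← Algebra.smul_def]
      cases w with
      | nil => rw [var_mul_nil]; simp [lowerCoeff]
      | cons k w =>
        rw [var_mul_cons]
        -- In `1 + c j`, the `c j` comes from the `z_j²` term of the denominator and the `1` from
        -- `-z_j` on the right-hand side.
        by_cases hk : k = j
        · subst hk
          rw [if_pos rfl, lowerCoeff_self_self, mk_apply, add_smul, one_smul]
          abel
        · rw [if_neg hk, lowerCoeff_self_of_ne c hk, one_smul]
          simp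
    · rw [if_neg hj, if_neg hj, if_neg hj, midCoeff_of_ne b hj, lowerCoeff_of_ne c hj]
      simp

theorem commute_const_map (x : NCPoly n) (f : NCSeries n ℝ) :
    const x * NCSeries.map (algebraMap ℝ (NCPoly n)) f =
      NCSeries.map (algebraMap ℝ (NCPoly n)) f * const x :=
  NCSeries.ext fun w => by
    rw [const_mul_apply, mul_const_apply, NCSeries.map_apply, Algebra.commutes]

/-- Multiplying the series form of the recursion by `V_i(z_i)` gives `V_i(z_i)(x_i - z_i) P = z_i
D_i P`. Summing over `i` yields `P - 1`, so `P` is a right inverse of the denominator, and a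
two-sided one because `P` is a unit. -/
theorem hasShefferGenFun_meixnerPoly (hr : ∀ i, MeixnerEquation (b i) (c i) (r i))
    (hV : ∀ i, meixnerDen (b i) (c i) * V i = PowerSeries.X) :
    HasShefferGenFun (∑ i, inVar i (r i)) (fun i => inVar i (V i)) (mk (meixnerPoly b c)) := by
  set ι := NCSeries.map (n := n) (algebraMap ℝ (NCPoly n)) with hι
  set P : NCSeries n (NCPoly n) := mk (meixnerPoly b c) with hP
  set D := shefferDenom (∑ i, inVar i (r i)) (fun i => inVar i (V i)) with hD
  have hDeq : D = 1 - ∑ i, ι (inVar i (V i)) * (const (xVar i) - var i) := by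
    have h1 : (NCSeries.mk fun w => ∑ i, xVar i * algebraMap ℝ (NCPoly n) (inVar i (V i) w)) =
        ∑ i, const (xVar i) * ι (inVar i (V i)) := NCSeries.ext fun w => by
      rw [NCSeries.sum_apply, mk_apply]
      exact Finset.sum_congr rfl fun i _ => by rw [const_mul_apply]; rfl
    have h2 : (NCSeries.mk fun w => algebraMap ℝ (NCPoly n)
        (ncComp (∑ i, inVar i (r i)) (fun i => inVar i (V i)) w)) =
        ∑ i, ι (inVar i (V i)) * var i := by
      change ι (ncComp (∑ i, inVar i (r i)) (fun i => inVar i (V i))) = _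
      rw [ncComp_sum_inVar hr hV, map_sum]
      refine Finset.sum_congr rfl fun i _ => ?_
      rw [← inVar_X_mul, mul_comm, inVar_mul, map_mul, inVar_X, map_var]
    rw [hD, shefferDenom, h1, h2]
    simp only [mul_sub, Finset.sum_sub_distrib, hι, commute_const_map]
    abel
  have hDP : D * P = 1 := by
    have h1 : ∀ i, ι (inVar i (V i)) * (const (xVar i) - var i) * P =
        var i * mk fun w => P (i :: w) := by
      intro i
      rw [mul_assoc, hP, ← meixnerDen_mul_meixnerPoly, ← mul_assoc, ← hι, ← map_mul, ← inVar_mul,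
        mul_comm, hV, inVar_X, map_var]
      rfl
    have h2 := eq_const_add_sum P
    have h3 : P [] = 1 := meixnerPoly_nil b c
    rw [h3, map_one] at h2
    rw [hDeq, sub_mul, one_mul, Finset.sum_mul, Finset.sum_congr rfl fun i _ => h1 i,
      sub_eq_iff_eq_add]
    exact h2
  refine ⟨?_, hDP⟩
  have hu : IsUnit P := isUnit_of_nil_eq_one P (meixnerPoly_nil b c)
  refine hu.mul_right_cancel ?_
  rw [mul_assoc, hDP, mul_one, one_mul]

theorem isFreeSheffer_iff {φ : NCPoly n →ₗ[ℝ] ℝ} (hr : ∀ i, MeixnerEquation (b i) (c i) (r i))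
    (hR : IsFreeCumulantSeries φ (∑ i, inVar i (r i))) {P : List (Fin n) → NCPoly n} :
    IsFreeSheffer φ P ↔ P = meixnerPoly b c := by
  choose V hV using fun i => exists_meixnerDen_mul_eq (b i) (c i)
  have hP := hasShefferGenFun_meixnerPoly hr hV
  constructor
  · rintro ⟨R', U, hR', hU, hP'⟩
    rw [← hR.unique hR'] at hU hP'
    rw [hU.eq_inVar hr hV] at hP'
    have e : (mk P : NCSeries n (NCPoly n)) = mk (meixnerPoly b c) :=
      left_inv_eq_right_inv hP'.1 hP.2
    exact e
  · rintro rfl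
    exact ⟨_, _, hR, isGradInverse_inVar hr hV, hP⟩

/-- If `w` does not start with `i`, it acts as a vacuum for `x_i`: neither diagonal nor lowering
term appears at `w`, and the first lowering coefficient above it is `1`. The recursion is then the
one-variable one. -/
theorem meixnerPoly_replicate_append (i : Fin n) (w : List (Fin n)) (hw : ∀ j ∈ w.head?, j ≠ i)
    (k : ℕ) : meixnerPoly b c (List.replicate k i ++ w) =
      Polynomial.aeval (xVar i) (oneVarPoly (b i) (c i) k) * meixnerPoly b c w := by
  have hm : midCoeff b i w = 0 := by
    cases w with
    | nil => rfl
    | cons j w => exact midCoeff_of_ne b (hw j rfl) w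
  have hl : lowerCoeff c i w = 0 := by
    cases w with
    | nil => rfl
    | cons j w => exact lowerCoeff_of_ne c (hw j rfl) w
  have hl1 : lowerCoeff c i (i :: w) = 1 := by
    cases w with
    | nil => simp [lowerCoeff]
    | cons j w => exact lowerCoeff_self_of_ne c (hw j rfl) w
  have h1 : meixnerPoly b c (i :: w) = xVar i * meixnerPoly b c w := by
    rw [meixnerPoly_cons, hm, hl, zero_smul, zero_smul, sub_zero, sub_zero]
  induction k using Nat.strong_induction_on with
  | _ k ih =>
    match k with
    | 0 => simp [oneVarPoly]
    | 1 => simpa [oneVarPoly] using h1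
    | 2 =>
      have h2 : List.replicate 2 i ++ w = i :: i :: w := rfl
      rw [h2, meixnerPoly_cons, List.tail_cons, hl1, midCoeff_self, h1, one_smul, oneVarPoly]
      simp [sub_mul, mul_assoc, Algebra.smul_def]
    | k + 3 =>
      have ih1 := ih (k + 1) (by omega)
      have ih2 := ih (k + 2) (by omega)
      have e : ∀ m, List.replicate (m + 1) i ++ w = i :: (List.replicate m i ++ w) := fun m => rfl
      rw [e (k + 2), meixnerPoly_cons, ih2, e (k + 1), List.tail_cons, ih1, midCoeff_self, e k,
        lowerCoeff_self_self, oneVarPoly]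
      simp [sub_mul, mul_assoc, Algebra.smul_def]

theorem meixnerPoly_flatMap (blocks : List (Fin n × ℕ)) (h1 : ∀ B ∈ blocks, 1 ≤ B.2)
    (h2 : blocks.IsChain fun B B' => B.1 ≠ B'.1) :
    meixnerPoly b c (blocks.flatMap fun B => List.replicate B.2 B.1) =
      (blocks.map fun B =>
        Polynomial.aeval (xVar B.1) (oneVarPoly (b B.1) (c B.1) B.2)).prod := by
  induction blocks with
  | nil => simp [meixnerPoly_nil]
  | cons B blocks ih =>
    rw [List.flatMap_cons, List.map_cons, List.prod_cons, meixnerPoly_replicate_append,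
      ih (fun B hB => h1 B (List.mem_cons_of_mem _ hB)) h2.tail]
    intro j hj
    cases blocks with
    | nil => simp at hj
    | cons B' blocks =>
      -- A positive exponent ensures that the rest of the word really starts with the letter of the
      -- next block.
      have h3 : 1 ≤ B'.2 := h1 B' (by simp)
      obtain ⟨m, hm⟩ := Nat.exists_eq_add_of_le' h3
      rw [List.flatMap_cons, hm, List.replicate_succ, List.cons_append, List.head?_cons,
        Option.mem_def, Option.some.injEq] at hj
      rw [← hj]
      exact (List.isChain_cons_cons.1 h2).1.symm

end Sheffer

/-! ### The free product in terms of its cumulant series. -/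

section FreeProduct

variable {n : ℕ} {r : Fin n → PowerSeries ℝ} {ψ : Fin n → (Polynomial ℝ →ₗ[ℝ] ℝ)}

theorem isFreeProduct_iff (hr : ∀ i, IsFreeCumulantSeries₁ (ψ i) (r i))
    {φ : NCPoly n →ₗ[ℝ] ℝ} :
    IsFreeProduct ψ φ ↔ φ 1 = 1 ∧ IsFreeCumulantSeries φ (∑ i, inVar i (r i)) := by
  have hcoeff : ∀ (i : Fin n) (k : ℕ), (∑ j, inVar j (r j)) (List.replicate k i) =
      PowerSeries.coeff k (r i) := by
    intro i k
    rw [NCSeries.sum_apply]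
    cases k with
    -- At the empty word all summands contribute, so all the constant terms must vanish.
    | zero =>
      rw [(hr i).1]
      exact Finset.sum_eq_zero fun j _ => by rw [List.replicate_zero, inVar_nil, (hr j).1]
    | succ k =>
      rw [Finset.sum_eq_single i, inVar_replicate]
      · exact fun j _ hj => inVar_eq_zero j _ ⟨i, by simp, hj.symm⟩
      · simp
  have hmixed : ∀ u : List (Fin n), (¬ ∃ i, ∀ j ∈ u, j = i) → (∑ j, inVar j (r j)) u = 0 := by
    intro u hu
    rw [NCSeries.sum_apply]
    refine Finset.sum_eq_zero fun i _ => ?_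
    push Not at hu
    exact inVar_eq_zero i _ (hu i)
  refine and_congr_right fun _ => ⟨?_, fun h => ⟨_, r, h, hr, hmixed, hcoeff⟩⟩
  rintro ⟨R, r', hR, hr', h1, h2⟩
  have e : R = ∑ i, inVar i (r i) := NCSeries.ext fun u => by
    -- The two cumulant conditions together fix every coefficient of `R`. For `n = 0` the empty word
    -- falls under the mixed case.
    by_cases hu : ∃ i, ∀ j ∈ u, j = i
    · obtain ⟨i, hi⟩ := hu
      rw [List.eq_replicate_of_mem hi, h2, hcoeff, (hr' i).unique (hr i)]
    · rw [h1 u hu, hmixed u hu]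
  rwa [e] at hR

end FreeProduct

end FreeMeixner

/-! ### The main theorem. -/

open FreeMeixner in
theorem mainTheorem8 (n : ℕ) (b c : Fin n → ℝ) :
    -- the one-dimensional states, and their polynomials, are well defined
    (∀ i, (∃! ψ : Polynomial ℝ →ₗ[ℝ] ℝ, IsFreeMeixnerState₁ (b i) (c i) ψ) ↔ -1 ≤ c i) ∧
    (∀ i, ∃! p : ℕ → Polynomial ℝ, IsFreeMeixnerPolynomials (b i) (c i) p) ∧
    ∀ ψ : Fin n → (Polynomial ℝ →ₗ[ℝ] ℝ), (∀ i, IsFreeMeixnerState₁ (b i) (c i) (ψ i)) →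
      (∃! φ : NCPoly n →ₗ[ℝ] ℝ, IsFreeProduct ψ φ) ∧
      ∀ φ : NCPoly n →ₗ[ℝ] ℝ, IsFreeProduct ψ φ →
        -- the free product is a free Meixner state
        IsFreeMeixnerState φ ∧ (IsFaithful φ ↔ ∀ i, -1 < c i) ∧
        -- its `R` is `∑ R_i(z_i)`, and `U_i` is the inverse under composition of `R_i(z_i)/z_i`
        (∃ r V : Fin n → PowerSeries ℝ,
          (∀ i, IsFreeCumulantSeries₁ (ψ i) (r i) ∧ MeixnerEquation (b i) (c i) (r i) ∧
            IsDivInverse₁ (r i) (V i)) ∧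
          IsFreeCumulantSeries φ (∑ i, inVar i (r i)) ∧
          IsGradInverse (∑ i, inVar i (r i)) (fun i => inVar i (V i))) ∧
        (∃! P : List (Fin n) → NCPoly n, IsFreeSheffer φ P) ∧
        ∀ P : List (Fin n) → NCPoly n, IsFreeSheffer φ P →
          IsOrthogonal φ P ∧
          -- the recursion
          (∀ i, xVar i * P [] = P [i]) ∧
          (∀ i j u, i ≠ j → xVar i * P (j :: u) = P (i :: j :: u)) ∧
          (∀ i, xVar i * P [i] = P [i, i] + b i • P [i] + P []) ∧
          (∀ i j u, i ≠ j →
            xVar i * P (i :: j :: u) = P (i :: i :: j :: u) + b i • P (i :: j :: u) + P (j :: u)) ∧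
          (∀ i u, xVar i * P (i :: i :: u) =
            P (i :: i :: i :: u) + b i • P (i :: i :: u) + (1 + c i) • P (i :: u)) ∧
          -- the product formula: the word is `v(1)^{i(1)} ⋯ v(k)^{i(k)}` with
          -- `v(j) ≠ v(j+1)`, given as the list of the pairs `(v(j), i(j))`
          ∀ p : Fin n → ℕ → Polynomial ℝ,
            (∀ i, IsFreeMeixnerPolynomials (b i) (c i) (p i)) →
            ∀ blocks : List (Fin n × ℕ), (∀ B ∈ blocks, 1 ≤ B.2) →
              blocks.IsChain (fun B B' => B.1 ≠ B'.1) →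
              P (blocks.flatMap fun B => List.replicate B.2 B.1) =
                (blocks.map fun B => Polynomial.aeval (xVar B.1) (p B.1 B.2)).prod := by
  refine ⟨fun i => ⟨fun ⟨ψ, h, _⟩ => h.neg_one_le, fun h => ?_⟩,
    fun i => ⟨_, isFreeMeixnerPolynomials_iff.2 rfl, fun p hp =>
      isFreeMeixnerPolynomials_iff.1 hp⟩, fun ψ hψ => ?_⟩
  · obtain ⟨ψ, hψ⟩ := exists_isFreeMeixnerState₁ (β := b i) h
    exact ⟨ψ, hψ, fun ψ' hψ' => hψ'.unique hψ⟩
  -- The bound on `c` is not assumed: it follows from the `ψ i` being states.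
  have hc : ∀ i, -1 ≤ c i := fun i => (hψ i).neg_one_le
  choose r hr hm using fun i => (hψ i).2
  choose V hV using fun i => exists_meixnerDen_mul_eq (b i) (c i)
  have hr0 : (∑ i, inVar i (r i)) [] = 0 := by
    rw [NCSeries.sum_apply]
    exact Finset.sum_eq_zero fun i _ => by rw [inVar_nil, (hr i).1]
  constructor
  · obtain ⟨φ, h1, hφ⟩ := exists_functional_of_cumulants hr0
    refine ⟨φ, (isFreeProduct_iff hr).2 ⟨h1, hφ⟩, fun φ' hφ' => ?_⟩
    have h := (isFreeProduct_iff hr).1 hφ'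
    exact functional_unique h.1 h1 h.2 hφ
  intro φ hφ
  obtain ⟨h1, hR⟩ := (isFreeProduct_iff hr).1 hφ
  have hstar := functional_star_mul hm h1 hR
  have hsheffer : ∀ P, IsFreeSheffer φ P ↔ P = meixnerPoly b c := fun P => isFreeSheffer_iff hm hR
  have horth : IsOrthogonal φ (meixnerPoly b c) := fun u v huv => by rw [hstar, if_neg huv]
  refine ⟨⟨functional_isState hm h1 hR hc, fun i => ?_, fun i j => ?_, meixnerPoly b c,
    (hsheffer _).2 rfl, horth⟩, functional_isFaithful_iff hm h1 hR hc,
    ⟨r, V, fun i => ⟨hr i, hm i, (isDivInverse₁_iff (hm i)).2 (hV i)⟩, hR,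
      isGradInverse_inVar hm hV⟩, ⟨_, (hsheffer _).2 rfl, fun P hP => (hsheffer P).1 hP⟩, ?_⟩
  -- Since `P_{(i)} = x_i`, mean and covariance are instances of the vanishing and orthogonality
  -- relations.
  · have := functional_meixnerPoly hm h1 hR [i]
    rwa [meixnerPoly, if_neg (by simp)] at this
  · have := hstar [i] [j]
    rw [meixnerPoly, meixnerPoly, star_xVar] at this
    rw [this]
    simp [weight, lowerCoeff]
  intro P hP
  rw [(hsheffer P).1 hP]
  have hx := xVar_mul_meixnerPoly b c
  refine ⟨horth, fun i => ?_, fun i j u hij => ?_, fun i => ?_, fun i j u hij => ?_,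
    fun i u => ?_, fun p hp blocks hB1 hB2 => ?_⟩
  · rw [hx, midCoeff, lowerCoeff, zero_smul, zero_smul, add_zero, add_zero]
  · rw [hx, midCoeff_of_ne b hij.symm, lowerCoeff_of_ne c hij.symm, zero_smul, zero_smul, add_zero,
      add_zero]
  · rw [hx, midCoeff_self, lowerCoeff, if_pos rfl, one_smul, List.tail_cons]
  · rw [hx, midCoeff_self, lowerCoeff_self_of_ne c hij.symm, one_smul, List.tail_cons]
  · rw [hx, midCoeff_self, lowerCoeff_self_self, List.tail_cons]
  · rw [meixnerPoly_flatMap blocks hB1 hB2]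
    simp only [fun i => isFreeMeixnerPolynomials_iff.1 (hp i)]
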